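/- Notation. Let $\mathbb H$ be the upper half-plane, $z=x+iy\in\mathbb H$. For $k\in 2\mathbb Z$ and $\operatorname{Re}(s)>1-\tfrac k2$ let $$E_k(z,s)=\frac12\sum_{(m,n)\in\mathbb Z^2\setminus\{(0,0)\}}\frac{y^s}{|mz+n|^{2s}(mz+n)^k},\qquad \widehat E_k(z,s)=\pi^{-(s+\frac k2)}\,\Gamma\!\left(s+\tfrac k2+\tfrac{|k|}2\right)E_k(z,s).$$ For every fixed $z$ the completed series $\widehat E_k(z,\cdot)$ continues to a meromorphic function on $\mathbb C$, denoted by the same symbol. It is entire if $k\neq0$, and holomorphic outside $\{0,1\}$ if $k=0$. The doubly-completed series is the entire function of $s$ $$\widehat{\widehat E}_k(z,s)=\left(s+\tfrac k2\right)\left(s+\tfrac k2-1\right)\widehat E_k(z,s)$$ (removable singularities removed). For a real-differentiable $f:\mathbb H\to\mathbb C$ put $$\xi_k f=2i\,y^k\,\overline{\frac{\partial f}{\partial\bar z}},\qquad \frac{\partial}{\partial\bar z}=\frac12\left(\frac{\partial}{\partial x}+i\frac{\partial}{\partial y}\right).$$ Proposition. Let $k\in2\mathbb Z$. The continuations just described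 exist. The functions $z\mapsto\widehat E_k(z,s)$ (for $s\in\mathbb C$, with $s\neq0,1$ if $k=0$) and $z\mapsto\widehat{\widehat E}_k(z,s)$ (for all $s\in\mathbb C$) are real-differentiable on $\mathbb H$. For all $z\in\mathbb H$ and all $s\in\mathbb C$, with $s\ne 0,1$ if $k=0$, $$\xi_k\widehat E_k(z,s)=\begin{cases}\widehat E_{2-k}(z,-\bar s)&\text{if }k\le0,\\[2pt] \bar s(\bar s+k-1)\,\widehat E_{2-k}(z,-\bar s)&\text{if }k\ge2,\end{cases}$$ where for $k=2$ and $s\in\{0,-1\}$, which are removable singularities of the right-hand side, the right-hand side is understood as its limit. Moreover, for all $z\in\mathbb H$ and all $s\in\mathbb C$, $$\xi_k\widehat{\widehat E}_k(z,s)=\begin{cases}\widehat{\widehat E}_{2-k}(z,-\bar s)&\text{if }k\le0,\\[2pt] \bar s(\bar s+k-1)\,\widehat{\widehat E}_{2-k}(z,-\bar s)&\text{if }k\ge2.\end{cases}$$ -/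

import Mathlib

open Filter Topology
open scoped ComplexConjugate UpperHalfPlane

noncomputable section

namespace PolyharmonicMaass

/-- The Eisenstein series of weight `k`, as an infinite series over nonzero pairs of integers:
`(1/2) ∑_{(m,n) ≠ (0,0)} y ^ s / (|m z + n| ^ (2 s) (m z + n) ^ k)`.
It converges (absolutely) for `Re s > 1 - k / 2`. -/
def eisensteinSeries (k : ℤ) (z : ℍ) (s : ℂ) : ℂ :=
  (1 / 2 : ℂ) * ∑' p : {p : ℤ × ℤ // p ≠ 0},
    ((z.im : ℝ) : ℂ) ^ s /
      (((‖(p.1.1 : ℂ) * (z : ℂ) + (p.1.2 : ℂ)‖ : ℝ) : ℂ) ^ (2 * s) *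
        ((p.1.1 : ℂ) * (z : ℂ) + (p.1.2 : ℂ)) ^ k)

/-- The completed series `π ^ (-(s + k/2)) Γ(s + k/2 + |k|/2) E_k(z, s)`, given by the
infinite series; meaningful for `Re s > 1 - k / 2`. -/
def completedEisensteinSeries (k : ℤ) (z : ℍ) (s : ℂ) : ℂ :=
  (Real.pi : ℂ) ^ (-(s + (k : ℂ) / 2)) *
    Complex.Gamma (s + (k : ℂ) / 2 + ((|k| : ℤ) : ℂ) / 2) * eisensteinSeries k z s

/-- `F` is a meromorphic function on the whole plane that agrees with `f` on the half-plane
`Re s > σ`. The normal form fixes the values of `F` pointwise: it is analytic at every point that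
is not a pole, and has the conventional value `0` at its poles. By the identity
theorem there is at most one such `F`. -/
def IsMeromorphicContinuation (F f : ℂ → ℂ) (σ : ℝ) : Prop :=
  MeromorphicNFOn F Set.univ ∧ ∀ s : ℂ, σ < s.re → F s = f s

/-- The meromorphic continuation to the plane of `f`, given on `Re s > σ`. -/
def meromorphicContinuation (f : ℂ → ℂ) (σ : ℝ) : ℂ → ℂ :=
  Classical.epsilon fun F => IsMeromorphicContinuation F f σ

/-- The completed Eisenstein series, continued meromorphically in `s` for each fixed `z`. -/
def completedEisenstein (k : ℤ) (z : ℍ) : ℂ → ℂ :=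
  meromorphicContinuation (completedEisensteinSeries k z) (1 - (k : ℝ) / 2)

/-- The doubly-completed Eisenstein series: the product of `(s + k/2) (s + k/2 - 1)` and the
completed Eisenstein series, as a meromorphic function of `s` (that is, with
the removable singularities removed). -/
def doublyCompletedEisenstein (k : ℤ) (z : ℍ) : ℂ → ℂ :=
  toMeromorphicNFOn
    (fun s : ℂ => (s + (k : ℂ) / 2) * (s + (k : ℂ) / 2 - 1) * completedEisenstein k z s) Set.univ

/-- A function on the upper half-plane is real differentiable at `z`, as a function of
`(x, y)`. -/
def RealDifferentiableAt (f : ℍ → ℂ) (z : ℍ) : Prop :=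
  DifferentiableAt ℝ (fun w : ℂ => f (UpperHalfPlane.ofComplex w)) (z : ℂ)

/-- The Wirtinger derivative `∂f/∂z̄ = (1/2) (∂f/∂x + i ∂f/∂y)` on the upper half-plane. -/
def wirtingerBar (f : ℍ → ℂ) (z : ℍ) : ℂ :=
  (1 / 2 : ℂ) * (fderiv ℝ (fun w : ℂ => f (UpperHalfPlane.ofComplex w)) (z : ℂ) 1 +
    Complex.I * fderiv ℝ (fun w : ℂ => f (UpperHalfPlane.ofComplex w)) (z : ℂ) Complex.I)

/-- The operator `ξ_k f = 2 i y ^ k * conj (∂f/∂z̄)`. -/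
def xi (k : ℤ) (f : ℍ → ℂ) (z : ℍ) : ℂ :=
  2 * Complex.I * ((z.im : ℝ) : ℂ) ^ k * conj (wirtingerBar f z)

/-- The points `s` at which the completed Eisenstein series of weight `k` has a pole:
`s = 0` and `s = 1` in weight `0`, and no points in the other weights. -/
def IsEisensteinPole (k : ℤ) (s : ℂ) : Prop := k = 0 ∧ (s = 0 ∨ s = 1)

end PolyharmonicMaass

end

/-! Write Q = |mz+n|²/y. Riemann's method turns the completed series into a sum that converges for
every s and can be differentiated term by term.

With S = s + max(k,0), the Gamma integral makes the completed series a Mellin transform in t of Σ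
(mz+n)^(-k) Q^max(k,0) exp(-πQt). With the zero pair included, this theta series satisfies θ(1/t) =
t^(|k|+1) θ(t) (`theta_functional_equation`). Folding (0,1] onto [1,∞) gives
`completedEisensteinSeries_eq`: an entire function of s, namely a lattice sum of incomplete Gamma
integrals, plus a polar part that occurs only for k = 0 and does not depend on z.

Since mz+n is holomorphic and ∂Q/∂z̄ is a multiple of (mz+n)²/y², the operator ∂/∂z̄ sends a lattice
sum of weight k with radial function g to one of weight k-2 with g' (`latticeSum_wirtinger`).
Conjugation (`latticeSum_conj`) then leads to weight 2-k, so `ξ_k` becomes a calculation with g.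

For k ≤ 0 the radial functions match exactly. For k ≥ 2 the recurrence of the incomplete Gamma
integral leaves the extra term (1-k+2πQ) exp(-πQ). Its lattice sum is evaluated by differentiating
the theta functional equation at t = 1 (`latticeSum_boundary`): it is 0 for k > 2 and 1 for k = 2,
where it accounts exactly for the polar part of weight 0. -/

namespace PolyharmonicMaass

/-! ### Lattice sums: convergence and Wirtinger derivative -/

/-- The linear form `m w + n` attached to the pair `p = (m, n)`. -/
noncomputable def lin (p : ℤ × ℤ) (w : ℂ) : ℂ := (p.1 : ℂ) * w + (p.2 : ℂ)

/-- The quadratic form `|m w + n| ^ 2 / Im w` attached to the pair `p = (m, n)`. -/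
noncomputable def quad (p : ℤ × ℤ) (w : ℂ) : ℝ := Complex.normSq (lin p w) / w.im

/-- The sum over nonzero pairs `p` of `(m w + n) ^ (-k) g (|m w + n| ^ 2 / Im w)`. -/
noncomputable def latticeSum (k : ℤ) (g : ℝ → ℂ) (w : ℂ) : ℂ :=
  ∑' p : {p : ℤ × ℤ // p ≠ 0}, lin p.1 w ^ (-k) * g (quad p.1 w)

theorem lin_ne_zero {p : ℤ × ℤ} (hp : p ≠ 0) {w : ℂ} (hw : 0 < w.im) : lin p w ≠ 0 := by
  intro h
  apply hp
  have h1 : (p.1 : ℝ) * w.im = 0 := by simpa [lin] using congrArg Complex.im h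
  have h2 : p.1 = 0 := by
    rcases mul_eq_zero.1 h1 with h | h
    · exact_mod_cast h
    · exact absurd h hw.ne'
  have h3 : p.2 = 0 := by simpa [lin, h2] using h
  exact Prod.ext h2 h3

theorem quad_pos {p : ℤ × ℤ} (hp : p ≠ 0) {w : ℂ} (hw : 0 < w.im) : 0 < quad p w :=
  div_pos (Complex.normSq_pos.2 (lin_ne_zero hp hw)) hw

theorem summable_norm_rpow_neg {a : ℝ} (ha : 2 < a) :
    Summable fun p : {p : ℤ × ℤ // p ≠ 0} => ‖p.1‖ ^ (-a) := by
  have h := EisensteinSeries.summable_one_div_norm_rpow ha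
  rw [← (finTwoArrowEquiv ℤ).symm.summable_iff] at h
  refine Summable.subtype (f := fun p : ℤ × ℤ => ‖p‖ ^ (-a)) ?_ _
  refine h.congr fun p => ?_
  simp [EisensteinSeries.norm_eq_max_natAbs, Prod.norm_def, Int.norm_eq_abs]

theorem exists_lower_bound {z : ℂ} (hz : 0 < z.im) :
    ∃ ε c b B : ℝ, 0 < ε ∧ 0 < c ∧ 0 < b ∧ 0 < B ∧ ∀ w ∈ Metric.ball z ε, b ≤ w.im ∧ w.im ≤ B ∧
      ∀ p : ℤ × ℤ, p ≠ 0 → c * ‖p‖ ≤ ‖lin p w‖ := by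
  have hb : 0 < z.im / 2 := by positivity
  -- The vertical strip with these bounds contains the ball of radius `z.im / 2` about `z`, so one
  -- constant `r z0` serves the whole ball.
  let z0 : ℍ := ⟨⟨|z.re| + z.im, z.im / 2⟩, hb⟩
  refine ⟨z.im / 2, EisensteinSeries.r z0, z.im / 2, 2 * z.im, hb,
    EisensteinSeries.r_pos _, hb, by positivity, ?_⟩
  intro w hw
  rw [Metric.mem_ball, dist_eq_norm] at hw
  have him := abs_lt.1 ((Complex.abs_im_le_norm (w - z)).trans_lt hw)
  have hre := (Complex.abs_re_le_norm (w - z)).trans_lt hw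
  simp only [Complex.sub_im, Complex.sub_re] at him hre
  refine ⟨by linarith, by linarith, fun p hp => ?_⟩
  have hw0 : 0 < w.im := by linarith
  let w0 : ℍ := ⟨w, hw0⟩
  have hmem : w0 ∈ UpperHalfPlane.verticalStrip (|z.re| + z.im) (z.im / 2) := by
    constructor
    · change |w.re| ≤ _
      have := abs_add_le (w.re - z.re) z.re
      simp only [sub_add_cancel] at this
      linarith
    · change z.im / 2 ≤ w.im
      linarith
  have h1 := EisensteinSeries.r_lower_bound_on_verticalStrip w0 hb hmem
  have hx : ![p.1, p.2] ≠ 0 := by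
    intro h
    exact hp (Prod.ext (by simpa using congrFun h 0) (by simpa using congrFun h 1))
  have h2 := EisensteinSeries.r_mul_max_le w0 hx
  have h3 : ‖![p.1, p.2]‖ = ‖p‖ := by
    simp [EisensteinSeries.norm_eq_max_natAbs, Prod.norm_def, Int.norm_eq_abs]
  rw [h3] at h2
  exact (mul_le_mul_of_nonneg_right h1 (norm_nonneg _)).trans h2

/-- Explains the recurring hypothesis `2 < 2 * A + k`: it is the convergence condition for a
rank-two lattice sum with this exponent. -/
theorem norm_lin_zpow_mul_quad_rpow {p : ℤ × ℤ} (hp : p ≠ 0) {w : ℂ} (hw : 0 < w.im) (k : ℤ)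
    (A : ℝ) : ‖lin p w ^ (-k)‖ * quad p w ^ (-A) = w.im ^ A * ‖lin p w‖ ^ (-(2 * A + k)) := by
  have hl : 0 < ‖lin p w‖ := norm_pos_iff.2 (lin_ne_zero hp hw)
  rw [norm_zpow, ← Real.rpow_intCast, quad, Complex.normSq_eq_norm_sq,
    Real.div_rpow (by positivity) hw.le, ← Real.rpow_natCast, ← Real.rpow_mul hl.le,
    Real.rpow_neg hw.le, div_inv_eq_mul, mul_comm (_ ^ _) (w.im ^ A), ← mul_assoc,
    mul_comm (_ ^ _) (w.im ^ A), mul_assoc, ← Real.rpow_add hl]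
  congr 2
  push_cast
  ring

/-- A bound for the terms of a lattice sum that is uniform on a neighbourhood of a point. -/
theorem exists_uniform_bound {z : ℂ} (hz : 0 < z.im) :
    ∃ ε D : ℝ, 0 < ε ∧ 0 < D ∧ (∀ w ∈ Metric.ball z ε, 0 < w.im ∧ 1 / w.im ≤ D ∧
      ∀ p : ℤ × ℤ, p ≠ 0 → |(p.1 : ℝ)| / ‖lin p w‖ ≤ D) ∧
    ∀ (k : ℤ) (A : ℝ), 2 < 2 * A + k → ∃ u : {p : ℤ × ℤ // p ≠ 0} → ℝ, Summable u ∧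
      ∀ w ∈ Metric.ball z ε, ∀ p : {p : ℤ × ℤ // p ≠ 0},
        ‖lin p.1 w ^ (-k)‖ * quad p.1 w ^ (-A) ≤ u p := by
  obtain ⟨ε, c, b, B, hε, hc, hb, hB, h⟩ := exists_lower_bound hz
  refine ⟨ε, max (1 / b) (1 / c), hε, lt_max_of_lt_left (by positivity), ?_, ?_⟩
  · intro w hw
    obtain ⟨h1, h2, h3⟩ := h w hw
    have hw0 : 0 < w.im := hb.trans_le h1
    refine ⟨hw0, (one_div_le_one_div_of_le hb h1).trans (le_max_left _ _), fun p hp => ?_⟩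
    refine le_trans ?_ (le_max_right _ _)
    rw [div_le_div_iff₀ (norm_pos_iff.2 (lin_ne_zero hp hw0)) hc, one_mul, mul_comm]
    refine le_trans ?_ (h3 p hp)
    gcongr
    rw [← Int.cast_abs, Int.cast_abs, ← Int.norm_eq_abs]
    exact norm_fst_le p
  · intro k A hk
    -- The sum `b ^ A + B ^ A` bounds `w.im ^ A` whatever the sign of `A`.
    refine ⟨fun p => (b ^ A + B ^ A) * (c ^ (-(2 * A + k)) * ‖p.1‖ ^ (-(2 * A + k))),
      ((summable_norm_rpow_neg hk).mul_left _).mul_left _, fun w hw p => ?_⟩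
    obtain ⟨h1, h2, h3⟩ := h w hw
    have hw0 : 0 < w.im := hb.trans_le h1
    rw [norm_lin_zpow_mul_quad_rpow p.2 hw0]
    dsimp only
    rw [← Real.mul_rpow hc.le (norm_nonneg _)]
    have hp : 0 < ‖p.1‖ := norm_pos_iff.2 p.2
    have him : w.im ^ A ≤ b ^ A + B ^ A := by
      rcases le_total 0 A with hA | hA
      · exact (Real.rpow_le_rpow hw0.le h2 hA).trans (le_add_of_nonneg_left (by positivity))
      · exact (Real.rpow_le_rpow_of_nonpos hb h1 hA).trans (le_add_of_nonneg_right (by positivity))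
    exact mul_le_mul him
      (Real.rpow_le_rpow_of_nonpos (by positivity) (h3 p.1 p.2) (by linarith)) (by positivity)
      (by positivity)

theorem summable_latticeSum_norm {k : ℤ} {A : ℝ} (hk : 2 < 2 * A + k) {z : ℂ}
    (hz : 0 < z.im) :
    Summable fun p : {p : ℤ × ℤ // p ≠ 0} => ‖lin p.1 z ^ (-k)‖ * quad p.1 z ^ (-A) := by
  obtain ⟨ε, D, hε, hD, h1, h2⟩ := exists_uniform_bound hz
  obtain ⟨u, hu, h⟩ := h2 k A hk
  refine hu.of_nonneg_of_le (fun p => ?_) (h z (Metric.mem_ball_self hε))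
  have := (quad_pos p.2 hz).le
  positivity

theorem summable_latticeSum {k : ℤ} {A C : ℝ} (hk : 2 < 2 * A + k) {g : ℝ → ℂ}
    (hg : ∀ x, 0 < x → ‖g x‖ ≤ C * x ^ (-A)) {z : ℂ} (hz : 0 < z.im) :
    Summable fun p : {p : ℤ × ℤ // p ≠ 0} => lin p.1 z ^ (-k) * g (quad p.1 z) := by
  refine ((summable_latticeSum_norm hk hz).mul_left C).of_norm_bounded fun p => ?_
  rw [norm_mul, mul_left_comm]
  gcongr
  exact hg _ (quad_pos p.2 hz)

/-- The derivative of `quad p` at `w`. -/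
noncomputable def quadDeriv (p : ℤ × ℤ) (w : ℂ) : ℂ →L[ℝ] ℝ :=
  (2 * (p.1 : ℝ) / w.im) • (Complex.reCLM ∘L (conj (lin p w) • ContinuousLinearMap.id ℝ ℂ)) -
    (Complex.normSq (lin p w) / w.im ^ 2) • Complex.imCLM

theorem hasFDerivAt_lin (p : ℤ × ℤ) (w : ℂ) :
    HasFDerivAt (lin p) ((p.1 : ℂ) • ContinuousLinearMap.id ℝ ℂ) w := by
  unfold lin
  exact ((hasFDerivAt_id w).const_mul (p.1 : ℂ)).add_const _

theorem hasFDerivAt_quad (p : ℤ × ℤ) {w : ℂ} (hw : 0 < w.im) :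
    HasFDerivAt (quad p) (quadDeriv p w) w := by
  have h1 : HasFDerivAt (fun w => (lin p w).re)
      (Complex.reCLM ∘L ((p.1 : ℂ) • ContinuousLinearMap.id ℝ ℂ)) w :=
    Complex.reCLM.hasFDerivAt.comp w (hasFDerivAt_lin p w)
  have h2 : HasFDerivAt (fun w => (lin p w).im)
      (Complex.imCLM ∘L ((p.1 : ℂ) • ContinuousLinearMap.id ℝ ℂ)) w :=
    Complex.imCLM.hasFDerivAt.comp w (hasFDerivAt_lin p w)
  have h3 : HasFDerivAt (fun w : ℂ => (w.im)⁻¹) ((-(w.im ^ 2)⁻¹) • Complex.imCLM) w :=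
    (hasDerivAt_inv hw.ne').comp_hasFDerivAt w Complex.imCLM.hasFDerivAt
  have h := ((h1.mul h1).add (h2.mul h2)).mul h3
  have he : quad p = fun w => ((lin p w).re * (lin p w).re + (lin p w).im * (lin p w).im) *
      (w.im)⁻¹ := by
    funext w
    rw [quad, Complex.normSq_apply, div_eq_mul_inv]
  rw [he]
  refine h.congr_fderiv ?_
  ext v
  simp [quadDeriv, Complex.normSq_apply]
  field_simp
  ring

/-- The logarithmic derivative of `quad p` is bounded uniformly in `p`. The factor `quad p w` gained
here is paid for by the faster decay of `g'`, so differentiation does not worsen convergence. -/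
theorem norm_quadDeriv_le (p : ℤ × ℤ) (hp : p ≠ 0) {w : ℂ} (hw : 0 < w.im) {D : ℝ}
    (h1 : 1 / w.im ≤ D) (h2 : |(p.1 : ℝ)| / ‖lin p w‖ ≤ D) :
    ‖quadDeriv p w‖ ≤ quad p w * (3 * D) := by
  have hl : 0 < ‖lin p w‖ := norm_pos_iff.2 (lin_ne_zero hp hw)
  have hq := quad_pos hp hw
  refine ContinuousLinearMap.opNorm_le_bound _ (by have : 0 < 1 / w.im := by positivity
                                                   have : 0 < D := this.trans_le h1
                                                   positivity) fun v => ?_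
  have e1 : ‖quadDeriv p w v‖ ≤ 2 * |(p.1 : ℝ)| / w.im * (‖lin p w‖ * ‖v‖) +
      Complex.normSq (lin p w) / w.im ^ 2 * ‖v‖ := by
    simp only [quadDeriv]
    rw [sub_apply]
    refine (norm_sub_le _ _).trans (add_le_add ?_ ?_)
    · simp only [smul_apply, ContinuousLinearMap.comp_apply, norm_smul,
        Complex.reCLM_apply, ContinuousLinearMap.id_apply]
      rw [norm_div, norm_mul, Real.norm_of_nonneg hw.le, Real.norm_eq_abs (p.1 : ℝ), Real.norm_two]
      gcongr
      refine (Complex.abs_re_le_norm _).trans ?_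
      simp
    · simp only [smul_apply, norm_smul, Complex.imCLM_apply]
      rw [norm_div, norm_pow, Real.norm_of_nonneg hw.le, Real.norm_of_nonneg (Complex.normSq_nonneg _)]
      refine mul_le_mul_of_nonneg_left (Complex.abs_im_le_norm _)
        (div_nonneg (Complex.normSq_nonneg _) (by positivity))
  refine e1.trans ?_
  have e2 : 2 * |(p.1 : ℝ)| / w.im * (‖lin p w‖ * ‖v‖) +
      Complex.normSq (lin p w) / w.im ^ 2 * ‖v‖ =
      quad p w * (2 * (|(p.1 : ℝ)| / ‖lin p w‖) + 1 / w.im) * ‖v‖ := by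
    rw [quad, Complex.normSq_eq_norm_sq]
    field_simp
  rw [e2]
  gcongr
  linarith

/-- The derivative of the term of index `p` of a lattice sum. -/
noncomputable def termDeriv (k : ℤ) (g g' : ℝ → ℂ) (p : ℤ × ℤ) (w : ℂ) : ℂ →L[ℝ] ℂ :=
  (g (quad p w) * (((-k : ℤ) : ℂ) * lin p w ^ (-k - 1) * (p.1 : ℂ))) • ContinuousLinearMap.id ℝ ℂ +
    (lin p w ^ (-k) * g' (quad p w)) • (Complex.ofRealCLM ∘L quadDeriv p w)

theorem hasFDerivAt_term (k : ℤ) {g g' : ℝ → ℂ} (hg : ∀ x, 0 < x → HasDerivAt g (g' x) x)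
    {p : ℤ × ℤ} (hp : p ≠ 0) {w : ℂ} (hw : 0 < w.im) :
    HasFDerivAt (fun w => lin p w ^ (-k) * g (quad p w)) (termDeriv k g g' p w) w := by
  have h1 : HasFDerivAt (fun w => lin p w ^ (-k))
      ((((-k : ℤ) : ℂ) * lin p w ^ (-k - 1) * (p.1 : ℂ)) • ContinuousLinearMap.id ℝ ℂ) w := by
    have ha : HasDerivAt (lin p) (p.1 : ℂ) w := by
      unfold lin
      simpa using ((hasDerivAt_id w).const_mul (p.1 : ℂ)).add_const (p.2 : ℂ)
    have hb := (hasDerivAt_zpow (-k) (lin p w) (Or.inl (lin_ne_zero hp hw))).comp w ha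
    refine (hb.hasFDerivAt.restrictScalars ℝ).congr_fderiv ?_
    ext v
    simp [mul_comm]
  have h2 : HasFDerivAt (fun w => g (quad p w))
      (g' (quad p w) • (Complex.ofRealCLM ∘L quadDeriv p w)) w := by
    have := (hg _ (quad_pos hp hw)).hasFDerivAt.comp w (hasFDerivAt_quad p hw)
    refine this.congr_fderiv ?_
    ext v
    simp [mul_comm]
  refine (h1.mul h2).congr_fderiv ?_
  ext v
  simp [termDeriv]
  ring

theorem norm_termDeriv_le (k : ℤ) {g g' : ℝ → ℂ} {A C : ℝ} (hC : 0 ≤ C)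
    (hb : ∀ x, 0 < x → ‖g x‖ ≤ C * x ^ (-A)) (hb' : ∀ x, 0 < x → ‖g' x‖ ≤ C * x ^ (-A - 1))
    {p : ℤ × ℤ} (hp : p ≠ 0) {w : ℂ} (hw : 0 < w.im) {D : ℝ}
    (h1 : 1 / w.im ≤ D) (h2 : |(p.1 : ℝ)| / ‖lin p w‖ ≤ D) :
    ‖termDeriv k g g' p w‖ ≤
      C * (|(k : ℝ)| * D + 3 * D) * (‖lin p w ^ (-k)‖ * quad p w ^ (-A)) := by
  have hl := lin_ne_zero hp hw
  have hl' : 0 < ‖lin p w‖ := norm_pos_iff.2 hl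
  have hq := quad_pos hp hw
  have e1 : ‖(g (quad p w) * (((-k : ℤ) : ℂ) * lin p w ^ (-k - 1) * (p.1 : ℂ))) •
      ContinuousLinearMap.id ℝ ℂ‖ ≤ C * quad p w ^ (-A) * (|(k : ℝ)| * ‖lin p w ^ (-k)‖ * D) := by
    rw [norm_smul]
    refine (mul_le_of_le_one_right (norm_nonneg _) ContinuousLinearMap.norm_id_le).trans ?_
    rw [norm_mul]
    refine mul_le_mul (hb _ hq) ?_ (norm_nonneg _) (by positivity)
    rw [norm_mul, norm_mul, zpow_sub_one₀ hl, norm_mul, norm_inv]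
    have e : ‖((-k : ℤ) : ℂ)‖ = |(k : ℝ)| := by simp
    have e' : ‖(p.1 : ℂ)‖ = |(p.1 : ℝ)| := by simp
    rw [e, e']
    calc _ = |(k : ℝ)| * ‖lin p w ^ (-k)‖ * (|(p.1 : ℝ)| / ‖lin p w‖) := by ring
      _ ≤ _ := by gcongr
  have e2 : ‖(lin p w ^ (-k) * g' (quad p w)) • (Complex.ofRealCLM ∘L quadDeriv p w)‖ ≤
      ‖lin p w ^ (-k)‖ * (C * quad p w ^ (-A - 1)) * (quad p w * (3 * D)) := by
    rw [norm_smul, norm_mul]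
    have : ‖Complex.ofRealCLM ∘L quadDeriv p w‖ ≤ quad p w * (3 * D) := by
      refine (ContinuousLinearMap.opNorm_comp_le _ _).trans ?_
      rw [Complex.ofRealCLM_norm, one_mul]
      exact norm_quadDeriv_le p hp hw h1 h2
    gcongr
    exact hb' _ hq
  refine (norm_add_le _ _).trans ((add_le_add e1 e2).trans (le_of_eq ?_))
  rw [Real.rpow_sub_one hq.ne']
  field_simp

theorem hasFDerivAt_latticeSum {k : ℤ} {g g' : ℝ → ℂ} {A C : ℝ} (hk : 2 < 2 * A + k)
    (hg : ∀ x, 0 < x → HasDerivAt g (g' x) x)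
    (hb : ∀ x, 0 < x → ‖g x‖ ≤ C * x ^ (-A)) (hb' : ∀ x, 0 < x → ‖g' x‖ ≤ C * x ^ (-A - 1))
    {z : ℂ} (hz : 0 < z.im) :
    Summable (fun p : {p : ℤ × ℤ // p ≠ 0} => termDeriv k g g' p.1 z) ∧
    HasFDerivAt (latticeSum k g) (∑' p : {p : ℤ × ℤ // p ≠ 0}, termDeriv k g g' p.1 z) z := by
  have hC : 0 ≤ C := by simpa using (norm_nonneg _).trans (hb 1 one_pos)
  obtain ⟨ε, D, hε, hD, h1, h2⟩ := exists_uniform_bound hz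
  obtain ⟨u, hu, h⟩ := h2 k A hk
  have hu' := hu.mul_left (C * (|(k : ℝ)| * D + 3 * D))
  have hbd : ∀ (p : {p : ℤ × ℤ // p ≠ 0}) (w : ℂ), w ∈ Metric.ball z ε →
      ‖termDeriv k g g' p.1 w‖ ≤ C * (|(k : ℝ)| * D + 3 * D) * u p := by
    intro p w hw
    obtain ⟨hw0, h3, h4⟩ := h1 w hw
    refine (norm_termDeriv_le k hC hb hb' p.2 hw0 h3 (h4 _ p.2)).trans ?_
    gcongr
    exact h w hw p
  have hz' := Metric.mem_ball_self (x := z) hε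
  refine ⟨hu'.of_norm_bounded fun p => hbd p z hz', ?_⟩
  exact hasFDerivAt_tsum_of_isPreconnected hu' Metric.isOpen_ball
    (convex_ball z ε).isPreconnected
    (fun p w hw => hasFDerivAt_term k hg p.2 (h1 w hw).1) hbd hz'
    (summable_latticeSum hk hb hz) hz'

/-- The holomorphic factor contributes 1 + i² = 0. Only `quad` survives, and its derivative supplies
the factor `lin p w ^ 2` that lowers the weight by two. -/
theorem termDeriv_wirtinger (k : ℤ) (g g' : ℝ → ℂ) {p : ℤ × ℤ} (hp : p ≠ 0) {w : ℂ}
    (hw : 0 < w.im) :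
    termDeriv k g g' p w 1 + Complex.I * termDeriv k g g' p w Complex.I =
      -Complex.I / (w.im : ℂ) ^ 2 * (lin p w ^ (-(k - 2)) * g' (quad p w)) := by
  have hl := lin_ne_zero hp hw
  have hw' : (w.im : ℂ) ≠ 0 := by exact_mod_cast hw.ne'
  have e : ((quadDeriv p w 1 : ℝ) : ℂ) + Complex.I * ((quadDeriv p w Complex.I : ℝ) : ℂ) =
      -Complex.I / (w.im : ℂ) ^ 2 * lin p w ^ 2 := by
    have e1 : lin p w = ((p.1 * w.re + p.2 : ℝ) : ℂ) + ((p.1 * w.im : ℝ) : ℂ) * Complex.I := by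
      rw [lin]
      conv_lhs => rw [← Complex.re_add_im w]
      push_cast
      ring
    have hr : (lin p w).re = p.1 * w.re + p.2 := by simp [lin]
    have hi : (lin p w).im = p.1 * w.im := by simp [lin]
    simp only [quadDeriv, sub_apply, smul_apply,
      ContinuousLinearMap.comp_apply, ContinuousLinearMap.id_apply, Complex.reCLM_apply,
      Complex.imCLM_apply, smul_eq_mul, mul_one, Complex.conj_re, Complex.one_im, mul_zero,
      Complex.I_im, Complex.mul_re, Complex.I_re, Complex.conj_im, Complex.normSq_apply, hr, hi]
    rw [e1]
    push_cast
    field_simp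
    linear_combination ((p.1 : ℂ) ^ 2 * w.im ^ 2 * Complex.I +
      2 * p.1 * w.im * (p.1 * w.re + p.2)) * Complex.I_sq
  have hz : lin p w ^ (-(k - 2)) = lin p w ^ (-k) * lin p w ^ 2 := by
    rw [← zpow_natCast, ← zpow_add₀ hl]
    congr 1
    push_cast
    ring
  rw [hz]
  simp only [termDeriv, add_apply, smul_apply,
    ContinuousLinearMap.comp_apply, ContinuousLinearMap.id_apply, Complex.ofRealCLM_apply,
    smul_eq_mul]
  linear_combination (lin p w ^ (-k) * g' (quad p w)) * e +
    (g (quad p w) * (((-k : ℤ) : ℂ) * lin p w ^ (-k - 1) * (p.1 : ℂ))) * Complex.I_sq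

theorem latticeSum_wirtinger {k : ℤ} {g g' : ℝ → ℂ} {A C : ℝ} (hk : 2 < 2 * A + k)
    (hg : ∀ x, 0 < x → HasDerivAt g (g' x) x)
    (hb : ∀ x, 0 < x → ‖g x‖ ≤ C * x ^ (-A)) (hb' : ∀ x, 0 < x → ‖g' x‖ ≤ C * x ^ (-A - 1))
    {z : ℂ} (hz : 0 < z.im) :
    DifferentiableAt ℝ (latticeSum k g) z ∧
    fderiv ℝ (latticeSum k g) z 1 + Complex.I * fderiv ℝ (latticeSum k g) z Complex.I =
      -Complex.I / (z.im : ℂ) ^ 2 * latticeSum (k - 2) g' z := by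
  obtain ⟨hs, hd⟩ := hasFDerivAt_latticeSum hk hg hb hb' hz
  refine ⟨hd.differentiableAt, ?_⟩
  have hs' (v : ℂ) : HasSum (fun p : {p : ℤ × ℤ // p ≠ 0} => termDeriv k g g' p.1 z v)
      ((∑' p : {p : ℤ × ℤ // p ≠ 0}, termDeriv k g g' p.1 z) v) :=
    hs.hasSum.mapL (ContinuousLinearMap.apply ℝ ℂ v)
  have h := (hs' 1).add ((hs' Complex.I).mul_left Complex.I)
  rw [hd.fderiv, ← h.tsum_eq, latticeSum, ← tsum_mul_left]
  exact tsum_congr fun p => termDeriv_wirtinger k g g' p.2 hz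

end PolyharmonicMaass

/-! ### The incomplete Gamma integral -/

namespace PolyharmonicMaass

open MeasureTheory Set in
/-- The incomplete Gamma integral `∫_1^∞ t ^ (S - 1) exp (-π x t) dt`. -/
noncomputable def incGamma (S : ℂ) (x : ℝ) : ℂ :=
  ∫ t : ℝ in Ioi 1, (t : ℂ) ^ (S - 1) * Real.exp (-(Real.pi * x * t))

open MeasureTheory Set

theorem aestronglyMeasurable_incGamma (S : ℂ) (x : ℝ) {s : Set ℝ} (hs : MeasurableSet s)
    (h : s ⊆ Ioi 0) :
    AEStronglyMeasurable (fun t : ℝ => (t : ℂ) ^ (S - 1) * Real.exp (-(Real.pi * x * t)))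
      (volume.restrict s) := by
  refine ContinuousOn.aestronglyMeasurable ?_ hs
  refine ContinuousOn.mul (fun t ht => ?_) (by fun_prop)
  exact (Complex.continuousAt_ofReal_cpow_const t (S - 1)
    (Or.inr (h ht).ne')).continuousWithinAt

theorem norm_cpow_mul_exp {S : ℂ} {x t : ℝ} (ht : 0 < t) :
    ‖(t : ℂ) ^ (S - 1) * (Real.exp (-(Real.pi * x * t)) : ℂ)‖ =
      t ^ (S.re - 1) * Real.exp (-(Real.pi * x * t)) := by
  rw [norm_mul, Complex.norm_cpow_eq_rpow_re_of_pos ht, Complex.norm_real,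
    Real.norm_of_nonneg (Real.exp_pos _).le]
  simp

theorem integrableOn_rpow_mul_exp {A x : ℝ} (hA : 0 < A) (hx : 0 < x) :
    IntegrableOn (fun t : ℝ => t ^ (A - 1) * Real.exp (-(Real.pi * x * t))) (Ioi 0) := by
  have := integrableOn_rpow_mul_exp_neg_mul_rpow (p := 1) (s := A - 1) (b := Real.pi * x)
    (by linarith) one_pos (by positivity)
  simpa using this

theorem integral_rpow_mul_exp {A x : ℝ} (hA : 0 < A) (hx : 0 < x) :
    ∫ t : ℝ in Ioi 0, t ^ (A - 1) * Real.exp (-(Real.pi * x * t)) =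
      Real.Gamma A * Real.pi ^ (-A) * x ^ (-A) := by
  rw [Real.integral_rpow_mul_exp_neg_mul_Ioi hA (by positivity), one_div,
    Real.inv_rpow (by positivity), ← Real.rpow_neg (by positivity),
    Real.mul_rpow Real.pi_pos.le hx.le]
  ring

theorem cpow_mul_exp_bound {S : ℂ} {A x t : ℝ} (hS : S.re ≤ A) (ht : t ∈ Ioi (1 : ℝ)) :
    ‖(t : ℂ) ^ (S - 1) * (Real.exp (-(Real.pi * x * t)) : ℂ)‖ ≤
      t ^ (A - 1) * Real.exp (-(Real.pi * x * t)) := by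
  rw [norm_cpow_mul_exp (zero_lt_one.trans ht)]
  gcongr
  exact le_of_lt ht

theorem integrableOn_incGamma (S : ℂ) {x : ℝ} (hx : 0 < x) :
    IntegrableOn (fun t : ℝ => (t : ℂ) ^ (S - 1) * Real.exp (-(Real.pi * x * t))) (Ioi 1) := by
  have hA : 0 < |S.re| + 1 := by positivity
  refine Integrable.mono' ((integrableOn_rpow_mul_exp hA hx).mono_set
    (Ioi_subset_Ioi zero_le_one)) (aestronglyMeasurable_incGamma S x measurableSet_Ioi
      (Ioi_subset_Ioi zero_le_one)) ?_
  filter_upwards [ae_restrict_mem measurableSet_Ioi] with t ht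
  exact cpow_mul_exp_bound (by linarith [le_abs_self S.re]) ht

/-- On t > 1 the exponent may be raised from Re S to `A`, after which the full Gamma integral
dominates. As `A` can be arbitrarily large, lattice sums of `incGamma` converge for every S. -/
theorem integral_norm_incGamma_le {S : ℂ} {A x : ℝ} (hA : 0 < A) (hS : S.re ≤ A) (hx : 0 < x) :
    ∫ t : ℝ in Ioi 1, ‖(t : ℂ) ^ (S - 1) * (Real.exp (-(Real.pi * x * t)) : ℂ)‖ ≤
      Real.Gamma A * Real.pi ^ (-A) * x ^ (-A) := by
  rw [← integral_rpow_mul_exp hA hx]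
  have hi := integrableOn_rpow_mul_exp hA hx
  refine (setIntegral_mono_on (integrableOn_incGamma S hx).norm
    (hi.mono_set (Ioi_subset_Ioi zero_le_one)) measurableSet_Ioi
    fun t ht => cpow_mul_exp_bound hS ht).trans ?_
  refine setIntegral_mono_set hi ?_ (Ioi_subset_Ioi zero_le_one).eventuallyLE
  filter_upwards [ae_restrict_mem measurableSet_Ioi] with t ht
  have : (0 : ℝ) < t := ht
  positivity

theorem norm_incGamma_le {S : ℂ} {A x : ℝ} (hA : 0 < A) (hS : S.re ≤ A) (hx : 0 < x) :
    ‖incGamma S x‖ ≤ Real.Gamma A * Real.pi ^ (-A) * x ^ (-A) :=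
  (norm_integral_le_integral_norm _).trans (integral_norm_incGamma_le hA hS hx)

theorem hasDerivAt_incGamma (S : ℂ) {x : ℝ} (hx : 0 < x) :
    HasDerivAt (incGamma S) (-Real.pi * incGamma (S + 1) x) x := by
  have hx2 : 0 < x / 2 := by positivity
  have h := (hasDerivAt_integral_of_dominated_loc_of_deriv_le (μ := volume.restrict (Ioi (1 : ℝ)))
    (F := fun (x : ℝ) (t : ℝ) => (t : ℂ) ^ (S - 1) * (Real.exp (-(Real.pi * x * t)) : ℂ))
    (F' := fun (x : ℝ) (t : ℝ) => -Real.pi * ((t : ℂ) ^ (S + 1 - 1) *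
      (Real.exp (-(Real.pi * x * t)) : ℂ)))
    -- For y > x/2 the exponential is largest at y = x/2.
    (bound := fun t => Real.pi * ‖(t : ℂ) ^ (S + 1 - 1) *
      (Real.exp (-(Real.pi * (x / 2) * t)) : ℂ)‖)
    (x₀ := x) (Ioi_mem_nhds (half_lt_self hx)) ?_ ?_ ?_ ?_ ?_ ?_).2
  · rw [integral_const_mul] at h
    exact h
  · exact Eventually.of_forall fun y => aestronglyMeasurable_incGamma S y measurableSet_Ioi
      (Ioi_subset_Ioi zero_le_one)
  · exact integrableOn_incGamma S hx
  · exact (aestronglyMeasurable_incGamma (S + 1) x measurableSet_Ioi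
      (Ioi_subset_Ioi zero_le_one)).const_mul _
  · filter_upwards [ae_restrict_mem measurableSet_Ioi] with t ht y hy
    have ht0 : (0 : ℝ) < t := zero_lt_one.trans ht
    rw [norm_mul, norm_cpow_mul_exp ht0, norm_cpow_mul_exp ht0]
    rw [norm_neg, Complex.norm_real, Real.norm_of_nonneg Real.pi_pos.le]
    gcongr
    exact le_of_lt hy
  · exact (integrableOn_incGamma (S + 1) hx2).norm.const_mul _
  · filter_upwards [ae_restrict_mem measurableSet_Ioi] with t ht y hy
    have ht0 : (t : ℂ) ≠ 0 := by exact_mod_cast (zero_lt_one.trans ht).ne'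
    have h1 : HasDerivAt (fun y : ℝ => Real.exp (-(Real.pi * y * t)))
        (Real.exp (-(Real.pi * y * t)) * -(Real.pi * t)) y := by
      simpa using ((((hasDerivAt_id y).const_mul Real.pi).mul_const t).neg).exp
    refine (h1.ofReal_comp.const_mul ((t : ℂ) ^ (S - 1))).congr_deriv ?_
    have : (t : ℂ) ^ (S + 1 - 1) = (t : ℂ) ^ (S - 1) * t := by
      rw [add_sub_right_comm, Complex.cpow_add _ _ ht0, Complex.cpow_one]
    rw [this]
    push_cast
    ring

/-- Integration of the derivative of t^S exp(-πxt) over [1,∞). The boundary value at t = 1 is the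
source of the exponential correction in weight k ≥ 2. -/
theorem incGamma_recurrence (S : ℂ) {x : ℝ} (hx : 0 < x) :
    S * incGamma S x - Real.pi * x * incGamma (S + 1) x = -Real.exp (-(Real.pi * x)) := by
  have hd : ∀ t ∈ Ici (1 : ℝ), HasDerivAt (fun t : ℝ => (t : ℂ) ^ S *
      (Real.exp (-(Real.pi * x * t)) : ℂ))
      (S * ((t : ℂ) ^ (S - 1) * (Real.exp (-(Real.pi * x * t)) : ℂ)) -
        Real.pi * x * ((t : ℂ) ^ (S + 1 - 1) * (Real.exp (-(Real.pi * x * t)) : ℂ))) t := by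
    intro t ht
    have ht0 : 0 < t := zero_lt_one.trans_le ht
    have h1 : HasDerivAt (fun t : ℝ => Real.exp (-(Real.pi * x * t)))
        (Real.exp (-(Real.pi * x * t)) * -(Real.pi * x)) t := by
      simpa using (((hasDerivAt_id t).const_mul (Real.pi * x)).neg).exp
    have h2 : HasDerivAt (fun t : ℝ => (t : ℂ) ^ S) (S * (t : ℂ) ^ (S - 1)) t := by
      have := (HasDerivAt.cpow_const (c := S) (hasDerivAt_id (t : ℂ))
        (Complex.ofReal_mem_slitPlane.2 ht0)).comp_ofReal
      simpa using this
    refine (h2.mul h1.ofReal_comp).congr_deriv ?_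
    rw [add_sub_cancel_right]
    push_cast
    ring
  have hlim : Tendsto (fun t : ℝ => (t : ℂ) ^ S * (Real.exp (-(Real.pi * x * t)) : ℂ)) atTop
      (𝓝 0) := by
    rw [tendsto_zero_iff_norm_tendsto_zero]
    have := tendsto_rpow_mul_exp_neg_mul_atTop_nhds_zero S.re (Real.pi * x) (by positivity)
    refine this.congr' ?_
    filter_upwards [eventually_gt_atTop 0] with t ht
    rw [norm_mul, Complex.norm_cpow_eq_rpow_re_of_pos ht, Complex.norm_real,
      Real.norm_of_nonneg (Real.exp_pos _).le, neg_mul]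
  have hi1 := (integrableOn_incGamma S hx).const_mul S
  have hi2 := (integrableOn_incGamma (S + 1) hx).const_mul ((Real.pi : ℂ) * x)
  have h := integral_Ioi_of_hasDerivAt_of_tendsto' hd (hi1.sub hi2) hlim
  rw [integral_sub hi1 hi2, integral_const_mul, integral_const_mul] at h
  simpa [incGamma] using h

/-- This is the Mellin transform of an exponential cut off below 1; vanishing near 0 removes any
restriction on Re S. -/
theorem differentiable_incGamma {x : ℝ} (hx : 0 < x) :
    Differentiable ℂ fun S => incGamma S x := by
  have he : (fun S => incGamma S x) =
      mellin ((Ioi 1).indicator fun t : ℝ => (Real.exp (-(Real.pi * x * t)) : ℂ)) := by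
    funext S
    rw [incGamma, mellin]
    have : (fun t : ℝ => (t : ℂ) ^ (S - 1) •
        (Ioi 1).indicator (fun t : ℝ => (Real.exp (-(Real.pi * x * t)) : ℂ)) t) =
        (Ioi 1).indicator fun t : ℝ => (t : ℂ) ^ (S - 1) * (Real.exp (-(Real.pi * x * t)) : ℂ) := by
      funext t
      by_cases ht : t ∈ Ioi (1 : ℝ) <;> simp [ht, -mem_Ioi]
    rw [this, setIntegral_indicator measurableSet_Ioi,
      inter_eq_self_of_subset_right (Ioi_subset_Ioi zero_le_one)]
  rw [he]
  intro S
  refine mellin_differentiableAt_of_isBigO_rpow_exp (a := Real.pi * x) (b := S.re - 1)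
    (by positivity) ?_ ?_ ?_ (by linarith)
  · exact ((Continuous.locallyIntegrable (by fun_prop)).indicator
      measurableSet_Ioi).locallyIntegrableOn _
  · refine Asymptotics.IsBigO.of_bound 1 (Eventually.of_forall fun t => ?_)
    rw [one_mul]
    refine (norm_indicator_le_norm_self _ _).trans ?_
    rw [Complex.norm_real, neg_mul]
  · refine Asymptotics.IsBigO.of_bound 1 ?_
    filter_upwards [mem_nhdsWithin_of_mem_nhds (Iio_mem_nhds (zero_lt_one' ℝ))] with t ht
    rw [indicator_of_notMem (by simpa using le_of_lt ht)]
    simp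

theorem incGamma_conj (S : ℂ) (x : ℝ) : conj (incGamma S x) = incGamma (conj S) x := by
  rw [incGamma, ← integral_conj, incGamma]
  refine setIntegral_congr_fun measurableSet_Ioi fun t ht => ?_
  have ht0 : 0 < t := zero_lt_one.trans ht
  have h1 : conj S - 1 = conj (S - 1) := by simp
  simp only [map_mul, Complex.conj_ofReal]
  rw [h1, Complex.cpow_conj _ _ (by rw [Complex.arg_ofReal_of_nonneg ht0.le]; exact Real.pi_pos.ne),
    Complex.conj_ofReal]

theorem integrableOn_Ioc_cpow_mul_exp {S : ℂ} (hS : 0 < S.re) {x : ℝ} (hx : 0 < x) :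
    IntegrableOn (fun t : ℝ => (t : ℂ) ^ (S - 1) * (Real.exp (-(Real.pi * x * t)) : ℂ))
      (Ioc 0 1) := by
  refine Integrable.mono' ((integrableOn_rpow_mul_exp hS hx).mono_set Ioc_subset_Ioi_self)
    (aestronglyMeasurable_incGamma S x measurableSet_Ioc Ioc_subset_Ioi_self) ?_
  filter_upwards [ae_restrict_mem measurableSet_Ioc] with t ht
  exact (norm_cpow_mul_exp ht.1).le

theorem integral_norm_Ioc_cpow_mul_exp_le {S : ℂ} (hS : 0 < S.re) {x : ℝ} (hx : 0 < x) :
    ∫ t : ℝ in Ioc 0 1, ‖(t : ℂ) ^ (S - 1) * (Real.exp (-(Real.pi * x * t)) : ℂ)‖ ≤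
      Real.Gamma S.re * Real.pi ^ (-S.re) * x ^ (-S.re) := by
  rw [← integral_rpow_mul_exp hS hx]
  have hi := integrableOn_rpow_mul_exp hS hx
  refine (setIntegral_mono_on (integrableOn_Ioc_cpow_mul_exp hS hx).norm
    (hi.mono_set Ioc_subset_Ioi_self) measurableSet_Ioc
    fun t ht => (norm_cpow_mul_exp ht.1).le).trans ?_
  refine setIntegral_mono_set hi ?_ Ioc_subset_Ioi_self.eventuallyLE
  filter_upwards [ae_restrict_mem measurableSet_Ioi] with t ht
  have : (0 : ℝ) < t := ht
  positivity

/-- The Gamma integral split at t = 1, the fixed point of t ↦ 1/t. -/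
theorem Gamma_mul_cpow_eq_incGamma_add {S : ℂ} (hS : 0 < S.re) {x : ℝ} (hx : 0 < x) :
    (Real.pi : ℂ) ^ (-S) * Complex.Gamma S * (x : ℂ) ^ (-S) =
      incGamma S x +
        ∫ t : ℝ in Ioc 0 1, (t : ℂ) ^ (S - 1) * (Real.exp (-(Real.pi * x * t)) : ℂ) := by
  have h := Complex.integral_cpow_mul_exp_neg_mul_Ioi hS (r := Real.pi * x)
    (mul_pos Real.pi_pos hx)
  rw [incGamma, add_comm, ← setIntegral_union Ioc_disjoint_Ioi_same measurableSet_Ioi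
    (integrableOn_Ioc_cpow_mul_exp hS hx) (integrableOn_incGamma S hx),
    Ioc_union_Ioi_eq_Ioi zero_le_one]
  have hpx : (1 / ((Real.pi * x : ℝ) : ℂ)) ^ S = (Real.pi : ℂ) ^ (-S) * (x : ℂ) ^ (-S) := by
    rw [one_div, Complex.inv_cpow _ _ (by
      rw [Complex.arg_ofReal_of_nonneg (by positivity)]; exact Real.pi_pos.ne),
      ← Complex.cpow_neg, Complex.ofReal_mul,
      Complex.mul_cpow_ofReal_nonneg Real.pi_pos.le hx.le]
  rw [hpx] at h
  rw [mul_right_comm, ← h]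
  refine setIntegral_congr_fun measurableSet_Ioi fun t ht => ?_
  push_cast
  rfl

end PolyharmonicMaass

/-! ### Decay classes of radial functions and conjugation of lattice sums -/

namespace PolyharmonicMaass

/-- `g` is bounded by a multiple of `x ^ (-A)` on the positive reals. -/
def PolyDecay (A : ℝ) (g : ℝ → ℂ) : Prop := ∃ C : ℝ, ∀ x, 0 < x → ‖g x‖ ≤ C * x ^ (-A)

theorem PolyDecay.add {A : ℝ} {f g : ℝ → ℂ} (hf : PolyDecay A f) (hg : PolyDecay A g) :
    PolyDecay A fun x => f x + g x := by
  obtain ⟨C, hC⟩ := hf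
  obtain ⟨D, hD⟩ := hg
  refine ⟨C + D, fun x hx => (norm_add_le _ _).trans ?_⟩
  rw [add_mul]
  exact add_le_add (hC x hx) (hD x hx)

theorem PolyDecay.const_mul {A : ℝ} {f : ℝ → ℂ} (hf : PolyDecay A f) (c : ℂ) :
    PolyDecay A fun x => c * f x := by
  obtain ⟨C, hC⟩ := hf
  refine ⟨‖c‖ * C, fun x hx => ?_⟩
  rw [norm_mul, mul_assoc]
  exact mul_le_mul_of_nonneg_left (hC x hx) (norm_nonneg _)

theorem PolyDecay.zpow_mul {A B : ℝ} {f : ℝ → ℂ} (hf : PolyDecay A f) (n : ℤ) (h : B = A - n) :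
    PolyDecay B fun x => (x : ℂ) ^ n * f x := by
  obtain ⟨C, hC⟩ := hf
  refine ⟨C, fun x hx => ?_⟩
  rw [norm_mul, norm_zpow, Complex.norm_real, Real.norm_of_nonneg hx.le, h, neg_sub, sub_eq_add_neg,
    Real.rpow_add hx, Real.rpow_intCast, mul_left_comm]
  exact mul_le_mul_of_nonneg_left (hC x hx) (by positivity)

theorem PolyDecay.congr {A : ℝ} {f g : ℝ → ℂ} (hf : PolyDecay A f)
    (h : ∀ x, 0 < x → g x = f x) : PolyDecay A g := by
  obtain ⟨C, hC⟩ := hf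
  exact ⟨C, fun x hx => by rw [h x hx]; exact hC x hx⟩

theorem polyDecay_incGamma {S : ℂ} {A : ℝ} (hA : 0 < A) (hS : S.re ≤ A) :
    PolyDecay A (incGamma S) :=
  ⟨_, fun _ hx => norm_incGamma_le hA hS hx⟩

/-- The function `x ↦ exp (-π x t)`, with complex values. -/
noncomputable def expPi (t x : ℝ) : ℂ := (Real.exp (-(Real.pi * x * t)) : ℂ)

/-- From u^n / n! ≤ exp u. -/
theorem polyDecay_expPi {t : ℝ} (ht : 0 < t) (n : ℕ) : PolyDecay n (expPi t) := by
  refine ⟨n.factorial / (Real.pi * t) ^ n, fun x hx => ?_⟩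
  have h := Real.pow_div_factorial_le_exp (Real.pi * x * t) (by positivity) n
  rw [expPi, Complex.norm_real, Real.norm_of_nonneg (Real.exp_pos _).le, Real.exp_neg,
    Real.rpow_neg hx.le, Real.rpow_natCast, ← div_eq_mul_inv, div_div, ← mul_pow,
    mul_right_comm Real.pi t x, inv_eq_one_div, div_le_div_iff₀ (Real.exp_pos _) (by positivity),
    one_mul, mul_comm (n.factorial : ℝ)]
  rwa [div_le_iff₀ (by positivity)] at h

theorem hasDerivAt_expPi (t x : ℝ) : HasDerivAt (expPi t) (-(Real.pi * t) * expPi t x) x := by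
  have h1 : HasDerivAt (fun x : ℝ => Real.exp (-(Real.pi * x * t)))
      (Real.exp (-(Real.pi * x * t)) * -(Real.pi * t)) x := by
    simpa using ((((hasDerivAt_id x).const_mul Real.pi).mul_const t).neg).exp
  refine h1.ofReal_comp.congr_deriv ?_
  rw [expPi]
  push_cast
  ring

theorem PolyDecay.summable {k : ℤ} {A : ℝ} {g : ℝ → ℂ} (hg : PolyDecay A g)
    (hk : 2 < 2 * A + k) {z : ℂ} (hz : 0 < z.im) :
    Summable fun p : {p : ℤ × ℤ // p ≠ 0} => lin p.1 z ^ (-k) * g (quad p.1 z) := by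
  obtain ⟨C, hC⟩ := hg
  exact summable_latticeSum hk hC hz

theorem PolyDecay.wirtinger {k : ℤ} {A : ℝ} {g g' : ℝ → ℂ} (hb : PolyDecay A g)
    (hb' : PolyDecay (A + 1) g') (hk : 2 < 2 * A + k)
    (hg : ∀ x, 0 < x → HasDerivAt g (g' x) x) {z : ℂ} (hz : 0 < z.im) :
    DifferentiableAt ℝ (latticeSum k g) z ∧
    fderiv ℝ (latticeSum k g) z 1 + Complex.I * fderiv ℝ (latticeSum k g) z Complex.I =
      -Complex.I / (z.im : ℂ) ^ 2 * latticeSum (k - 2) g' z := by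
  obtain ⟨C, hC⟩ := hb
  obtain ⟨C', hC'⟩ := hb'
  refine latticeSum_wirtinger (C := max C C') hk hg (fun x hx => (hC x hx).trans ?_)
    (fun x hx => ?_) hz
  · gcongr
    exact le_max_left _ _
  · refine (hC' x hx).trans ?_
    rw [show -(A + 1) = -A - 1 by ring]
    gcongr
    exact le_max_right _ _

theorem latticeSum_congr {k : ℤ} {f g : ℝ → ℂ} (h : ∀ x, 0 < x → f x = g x) {z : ℂ}
    (hz : 0 < z.im) : latticeSum k f z = latticeSum k g z :=
  tsum_congr fun p => by rw [h _ (quad_pos p.2 hz)]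

theorem latticeSum_const_mul (k : ℤ) (c : ℂ) (g : ℝ → ℂ) (z : ℂ) :
    latticeSum k (fun x => c * g x) z = c * latticeSum k g z := by
  rw [latticeSum, latticeSum, ← tsum_mul_left]
  exact tsum_congr fun p => by ring

theorem latticeSum_add {k : ℤ} {A : ℝ} {f g : ℝ → ℂ} (hf : PolyDecay A f) (hg : PolyDecay A g)
    (hk : 2 < 2 * A + k) {z : ℂ} (hz : 0 < z.im) :
    latticeSum k (fun x => f x + g x) z = latticeSum k f z + latticeSum k g z := by
  rw [latticeSum, latticeSum, latticeSum, ← (hf.summable hk hz).tsum_add (hg.summable hk hz)]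
  exact tsum_congr fun p => by ring

theorem conj_lin (p : {p : ℤ × ℤ // p ≠ 0}) {z : ℂ} (hz : 0 < z.im) :
    conj (lin p.1 z) = (quad p.1 z : ℂ) * z.im * (lin p.1 z)⁻¹ := by
  have hl := lin_ne_zero p.2 hz
  have hz' : (z.im : ℂ) ≠ 0 := by exact_mod_cast hz.ne'
  rw [quad, Complex.ofReal_div, div_mul_cancel₀ _ hz', Complex.normSq_eq_conj_mul_self,
    mul_inv_cancel_right₀ hl]

/-- Since conj(mz+n) = Q y / (mz+n), conjugation reverses the weight at the cost of powers of Q and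
y. -/
theorem latticeSum_conj (k : ℤ) (g : ℝ → ℂ) {z : ℂ} (hz : 0 < z.im) :
    conj (latticeSum k g z) =
      (z.im : ℂ) ^ (-k) * latticeSum (-k) (fun x => (x : ℂ) ^ (-k) * conj (g x)) z := by
  rw [latticeSum, Complex.conj_tsum, latticeSum, ← tsum_mul_left]
  refine tsum_congr fun p => ?_
  rw [map_mul, map_zpow₀, conj_lin p hz, mul_zpow, mul_zpow, inv_zpow']
  ring

/-! ### Theta series and their functional equation -/

theorem tsum_eq_latticeSum_add {t : ℝ} (ht : 0 < t) {z : ℂ} (hz : 0 < z.im) :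
    HasSum (fun p : ℤ × ℤ => expPi t (quad p z)) (latticeSum 0 (expPi t) z + 1) := by
  have h : HasSum (fun p : {p : ℤ × ℤ // p ≠ 0} => expPi t (quad p.1 z))
      (latticeSum 0 (expPi t) z) := by
    have := ((polyDecay_expPi ht 2).summable (k := 0) (by norm_num) hz).hasSum
    simpa [latticeSum] using this
  have h2 : HasSum (fun p : ({0} : Set (ℤ × ℤ)) => expPi t (quad p.1 z)) 1 := by
    have := hasSum_unique (fun p : ({0} : Set (ℤ × ℤ)) => expPi t (quad p.1 z))
    convert this
    change 1 = expPi t (quad 0 z)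
    simp [quad, lin, expPi]
  rw [add_comm]
  refine h2.add_compl ?_
  exact h

/-- In absolute value each term is a product of a Gaussian in `p.1` and a Gaussian in `p.2`. -/
theorem summable_poisson_side {t y : ℝ} (ht : 0 < t) (hy : 0 < y) (x : ℝ) :
    Summable fun p : ℤ × ℤ => Complex.exp (-(Real.pi * t * y) * (p.1 : ℂ) ^ 2) *
      Complex.exp (2 * Real.pi * Complex.I * p.2 * (p.1 * x) +
        Real.pi * Complex.I * p.2 ^ 2 * (Complex.I * y / t)) := by
  have h1 : Summable fun n : ℤ => Real.exp (-(Real.pi * t * y) * (n : ℝ) ^ 2) := by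
    have := (summable_jacobiTheta₂_term_iff 0 (Complex.I * (t * y : ℝ))).2
      (by simp; positivity)
    refine this.norm.congr fun n => ?_
    rw [norm_jacobiTheta₂_term]
    congr 1
    simp
    ring
  have h2 : Summable fun n : ℤ => Real.exp (-(Real.pi * y / t) * (n : ℝ) ^ 2) := by
    have := (summable_jacobiTheta₂_term_iff 0 (Complex.I * (y / t : ℝ))).2
      (by simp; positivity)
    refine this.norm.congr fun n => ?_
    rw [norm_jacobiTheta₂_term]
    congr 1
    simp
    ring
  refine ((h1.mul_of_nonneg h2 (fun _ => (Real.exp_pos _).le)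
    (fun _ => (Real.exp_pos _).le))).of_norm_bounded fun p => le_of_eq ?_
  rw [norm_mul, Complex.norm_exp, Complex.norm_exp]
  congr 2
  · rw [← Complex.ofReal_intCast, ← Complex.ofReal_pow, ← Complex.ofReal_mul,
      ← Complex.ofReal_mul, ← Complex.ofReal_neg, ← Complex.ofReal_mul, Complex.ofReal_re]
  · have : (2 * Real.pi * Complex.I * p.2 * (p.1 * x) +
        Real.pi * Complex.I * p.2 ^ 2 * (Complex.I * y / t) : ℂ) =
        ((-(Real.pi * y / t) * (p.2 : ℝ) ^ 2 : ℝ) : ℂ) +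
        ((2 * Real.pi * p.2 * (p.1 * x) : ℝ) : ℂ) * Complex.I := by
      push_cast
      linear_combination (Real.pi * p.2 ^ 2 * y / t : ℂ) * Complex.I_sq
    rw [this]
    simp [-Complex.ofReal_mul, -Complex.ofReal_neg, -Complex.ofReal_pow]

/-- Poisson summation in n for fixed m, in the form of the Jacobi functional equation with τ = it/y
and elliptic variable m x τ. -/
theorem tsum_row {t : ℝ} (ht : 0 < t) {z : ℂ} (hz : 0 < z.im) (m : ℤ) :
    ∑' n : ℤ, expPi t (quad (m, n) z) =
      (1 / ((t / z.im : ℝ) : ℂ) ^ (1 / 2 : ℂ)) * ∑' l : ℤ,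
        Complex.exp (-(Real.pi * t * z.im) * (m : ℂ) ^ 2) *
        Complex.exp (2 * Real.pi * Complex.I * l * (m * z.re) +
        Real.pi * Complex.I * l ^ 2 * (Complex.I * z.im / t)) := by
  have hy : (z.im : ℂ) ≠ 0 := by exact_mod_cast hz.ne'
  have ht' : (t : ℂ) ≠ 0 := by exact_mod_cast ht.ne'
  have h := jacobiTheta₂_functional_equation (m * z.re * (Complex.I * t / z.im))
    (Complex.I * t / z.im)
  have e1 : -Complex.I * (Complex.I * t / z.im) = ((t / z.im : ℝ) : ℂ) := by
    push_cast
    linear_combination (-t / z.im : ℂ) * Complex.I_sq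
  have e2 : m * z.re * (Complex.I * t / z.im) / (Complex.I * t / z.im) = (m * z.re : ℂ) := by
    field_simp
  have e3 : -1 / (Complex.I * t / z.im) = Complex.I * z.im / t := by
    field_simp
    linear_combination -Complex.I_sq
  have e4 : -Real.pi * Complex.I * (m * z.re * (Complex.I * t / z.im)) ^ 2 /
      (Complex.I * t / z.im) = Real.pi * m ^ 2 * z.re ^ 2 * t / z.im := by
    field_simp
    linear_combination (-(m : ℂ) ^ 2 * z.re ^ 2) * Complex.I_sq
  rw [e1, e2, e3, e4] at h
  have hl : ∑' n : ℤ, expPi t (quad (m, n) z) =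
      Complex.exp (-(Real.pi * t * z.im) * (m : ℂ) ^ 2) *
      Complex.exp (-(Real.pi * m ^ 2 * z.re ^ 2 * t / z.im)) *
      jacobiTheta₂ (m * z.re * (Complex.I * t / z.im)) (Complex.I * t / z.im) := by
    rw [jacobiTheta₂, ← tsum_mul_left]
    refine tsum_congr fun n => ?_
    rw [expPi, jacobiTheta₂_term, ← Complex.exp_add, ← Complex.exp_add, Complex.ofReal_exp]
    congr 1
    have hq : (quad (m, n) z : ℝ) = ((m * z.re + n) ^ 2 + (m * z.im) ^ 2) / z.im := by
      rw [quad, Complex.normSq_apply]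
      simp [lin]
      ring
    rw [hq]
    push_cast
    field_simp
    linear_combination (-(2 * n * m * z.re + n ^ 2) : ℂ) * Complex.I_sq
  rw [hl, h, jacobiTheta₂, tsum_mul_left]
  have e5 : Complex.exp (-(Real.pi * m ^ 2 * z.re ^ 2 * t / z.im)) *
      Complex.exp (Real.pi * m ^ 2 * z.re ^ 2 * t / z.im) = 1 := by
    rw [← Complex.exp_add, neg_add_cancel, Complex.exp_zero]
  simp only [jacobiTheta₂_term]
  linear_combination (Complex.exp (-(Real.pi * t * z.im) * (m : ℂ) ^ 2) *
    (1 / ((t / z.im : ℝ) : ℂ) ^ (1 / 2 : ℂ)) * ∑' l : ℤ,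
        Complex.exp (2 * Real.pi * Complex.I * l * (m * z.re) +
        Real.pi * Complex.I * l ^ 2 * (Complex.I * z.im / t))) * e5

theorem latticeSum_eq_poisson_side {t : ℝ} (ht : 0 < t) {z : ℂ} (hz : 0 < z.im) :
    latticeSum 0 (expPi t) z + 1 = (1 / ((t / z.im : ℝ) : ℂ) ^ (1 / 2 : ℂ)) *
      ∑' p : ℤ × ℤ, Complex.exp (-(Real.pi * t * z.im) * (p.1 : ℂ) ^ 2) *
      Complex.exp (2 * Real.pi * Complex.I * p.2 * (p.1 * z.re) +
        Real.pi * Complex.I * p.2 ^ 2 * (Complex.I * z.im / t)) := by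
  have h := tsum_eq_latticeSum_add ht hz
  rw [← h.tsum_eq, h.summable.tsum_prod, (summable_poisson_side ht hz z.re).tsum_prod,
    ← tsum_mul_left]
  exact tsum_congr fun m => tsum_row ht hz m

/-- After Poisson summation in one variable, t ↦ 1/t merely exchanges the two summation indices; the
square-root prefactors differ by the factor t. -/
theorem theta_weight_zero {t : ℝ} (ht : 0 < t) {z : ℂ} (hz : 0 < z.im) :
    latticeSum 0 (expPi t⁻¹) z + 1 = t * (latticeSum 0 (expPi t) z + 1) := by
  have ht' : (t : ℂ) ≠ 0 := by exact_mod_cast ht.ne'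
  rw [latticeSum_eq_poisson_side ht hz, latticeSum_eq_poisson_side (inv_pos.2 ht) hz, ← mul_assoc]
  congr 1
  · have h1 : ((1 : ℝ) / 2 : ℝ) = (1 / 2 : ℂ) := by push_cast; rfl
    rw [← h1, ← Complex.ofReal_cpow (by positivity), ← Complex.ofReal_cpow (by positivity)]
    rw [← Real.sqrt_eq_rpow, ← Real.sqrt_eq_rpow, Real.sqrt_div (by positivity),
      Real.sqrt_div (by positivity), Real.sqrt_inv]
    have h2 : 0 < Real.sqrt t := Real.sqrt_pos.2 ht
    have h3 : (t : ℂ) = (Real.sqrt t : ℂ) * (Real.sqrt t : ℂ) := by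
      rw [← Complex.ofReal_mul, Real.mul_self_sqrt ht.le]
    have h4 : (Real.sqrt t : ℂ) ≠ 0 := by exact_mod_cast h2.ne'
    have h5 : (Real.sqrt z.im : ℂ) ≠ 0 := by exact_mod_cast (Real.sqrt_pos.2 hz).ne'
    rw [h3]
    push_cast
    field_simp
  · rw [← (Equiv.prodComm ℤ ℤ).tsum_eq]
    refine tsum_congr fun p => ?_
    simp only [Equiv.prodComm_apply, Prod.fst_swap, Prod.snd_swap]
    rw [← Complex.exp_add, ← Complex.exp_add]
    congr 1
    push_cast
    field_simp
    linear_combination (z.im * t ^ 2 * p.1 ^ 2 - z.im * p.2 ^ 2 : ℂ) * Complex.I_sq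

theorem latticeSum_expPi_wirtinger (k : ℤ) {t : ℝ} (ht : 0 < t) {z : ℂ} (hz : 0 < z.im) :
    DifferentiableAt ℝ (latticeSum k (expPi t)) z ∧
    fderiv ℝ (latticeSum k (expPi t)) z 1 +
      Complex.I * fderiv ℝ (latticeSum k (expPi t)) z Complex.I =
      Complex.I / (z.im : ℂ) ^ 2 * (Real.pi * t * latticeSum (k - 2) (expPi t) z) := by
  have hk : (2 : ℝ) < 2 * ((k.natAbs + 2 : ℕ) : ℝ) + k := by
    rw [Nat.cast_add, Nat.cast_natAbs, Int.cast_abs]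
    push_cast
    linarith [neg_abs_le (k : ℝ), abs_nonneg (k : ℝ)]
  have h := (polyDecay_expPi ht (k.natAbs + 2)).wirtinger (k := k)
    (g' := fun x => -(Real.pi * t) * expPi t x)
    (by have := (polyDecay_expPi ht (k.natAbs + 2 + 1)).const_mul (-(Real.pi * t))
        push_cast at this ⊢
        exact this) hk (fun x _ => hasDerivAt_expPi t x) hz
  refine ⟨h.1, ?_⟩
  rw [h.2, latticeSum_const_mul]
  ring

/-- Induction by applying ∂/∂z̄ to both sides. This lowers the weight by two and produces 1/t on the
left and t on the right, so the power of t grows by two. The zero-pair constant is killed at the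
first step. -/
theorem theta_weight_neg (n : ℕ) {t : ℝ} (ht : 0 < t) {z : ℂ} (hz : 0 < z.im) :
    latticeSum (-(2 * n : ℕ)) (expPi t⁻¹) z + (if n = 0 then 1 else 0) =
      t ^ (2 * n + 1) * (latticeSum (-(2 * n : ℕ)) (expPi t) z + (if n = 0 then 1 else 0)) := by
  induction n generalizing z with
  | zero => simpa using theta_weight_zero ht hz
  | succ n ih =>
    have ht' : (t : ℂ) ≠ 0 := by exact_mod_cast ht.ne'
    have hy : (z.im : ℂ) ≠ 0 := by exact_mod_cast hz.ne'
    obtain ⟨hd1, hw1⟩ := latticeSum_expPi_wirtinger (-(2 * n : ℕ)) (inv_pos.2 ht) hz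
    obtain ⟨hd2, hw2⟩ := latticeSum_expPi_wirtinger (-(2 * n : ℕ)) ht hz
    have he : (fun w => latticeSum (-(2 * n : ℕ)) (expPi t⁻¹) w + (if n = 0 then 1 else 0))
        =ᶠ[𝓝 z] fun w => (t : ℂ) ^ (2 * n + 1) *
          (latticeSum (-(2 * n : ℕ)) (expPi t) w + (if n = 0 then 1 else 0)) := by
      filter_upwards [(isOpen_lt continuous_const Complex.continuous_im).mem_nhds hz] with w hw
      exact ih hw
    have hf := he.fderiv_eq (𝕜 := ℝ)
    rw [fderiv_add_const, fderiv_const_mul (hd2.add_const _), fderiv_add_const] at hf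
    have h1 := DFunLike.congr_fun hf 1
    have h2 := DFunLike.congr_fun hf Complex.I
    simp only [smul_apply, smul_eq_mul] at h1 h2
    rw [h1, h2] at hw1
    have hk : (-(2 * n : ℕ) : ℤ) - 2 = -(2 * (n + 1) : ℕ) := by push_cast; ring
    rw [hk] at hw1 hw2
    simp only [Nat.succ_ne_zero, if_false, add_zero]
    have h3 : Complex.I / (z.im : ℂ) ^ 2 * (Real.pi * (t⁻¹ : ℝ) *
        latticeSum (-(2 * (n + 1) : ℕ)) (expPi t⁻¹) z) = t ^ (2 * n + 1) *
        (Complex.I / (z.im : ℂ) ^ 2 * (Real.pi * t *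
          latticeSum (-(2 * (n + 1) : ℕ)) (expPi t) z)) := by
      rw [← hw1, ← hw2]
      ring
    have hpi : (Real.pi : ℂ) ≠ 0 := by exact_mod_cast Real.pi_ne_zero
    generalize latticeSum (-(2 * (n + 1) : ℕ)) (expPi t⁻¹) z = X at h3 ⊢
    push_cast at h3 ⊢
    field_simp at h3
    rw [h3]
    ring

/-- The functional equation of the theta series with the spherical polynomial of weight `k`. -/
theorem theta_functional_equation {k : ℤ} (hk : Even k) {t : ℝ} (ht : 0 < t) {z : ℂ}
    (hz : 0 < z.im) :
    latticeSum k (fun x => (x : ℂ) ^ k.toNat * expPi t⁻¹ x) z + (if k = 0 then 1 else 0) =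
      t ^ (k.natAbs + 1) *
        (latticeSum k (fun x => (x : ℂ) ^ k.toNat * expPi t x) z + (if k = 0 then 1 else 0)) := by
  obtain ⟨j, hj⟩ := hk
  rcases le_total k 0 with h0 | h0
  · obtain ⟨n, hn⟩ := Int.eq_ofNat_of_zero_le (neg_nonneg.2 (show j ≤ 0 by omega))
    have hkn : k = -(2 * n : ℕ) := by push_cast; omega
    have h := theta_weight_neg n ht hz
    have e1 : k.toNat = 0 := Int.toNat_of_nonpos h0
    have e2 : k.natAbs = 2 * n := by omega
    have e3 : (k = 0) ↔ n = 0 := by omega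
    simp only [e1, pow_zero, one_mul, e2, e3]
    rw [hkn]
    exact h
  · obtain ⟨n, hn⟩ := Int.eq_ofNat_of_zero_le (show 0 ≤ j by omega)
    have hkn : -k = -(2 * n : ℕ) := by push_cast; omega
    have h := congrArg conj (theta_weight_neg n ht hz)
    have e2 : k.natAbs = 2 * n := by omega
    have e3 : (k = 0) ↔ n = 0 := by omega
    have hy : (z.im : ℂ) ^ k ≠ 0 := zpow_ne_zero _ (by exact_mod_cast hz.ne')
    -- Positive weight is the complex conjugate of negative weight, up to a power of y.
    have e4 (s : ℝ) : conj (latticeSum (-k) (expPi s) z) =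
        (z.im : ℂ) ^ k * latticeSum k (fun x => (x : ℂ) ^ k.toNat * expPi s x) z := by
      rw [latticeSum_conj _ _ hz, neg_neg]
      congr 2
      funext x
      rw [expPi, Complex.conj_ofReal, ← zpow_natCast, Int.toNat_of_nonneg h0]
    rw [← hkn, map_add, map_mul, map_add, e4, e4, map_pow, Complex.conj_ofReal] at h
    rw [e2]
    simp only [e3]
    by_cases hn0 : n = 0
    · subst hn0
      have hk0 : k = 0 := by omega
      subst hk0
      simpa using h
    · simp only [hn0, if_false, map_zero, add_zero] at h ⊢
      apply mul_left_cancel₀ hy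
      rw [h]
      ring

end PolyharmonicMaass

/-! ### Riemann's method: folding the Mellin integral -/

namespace PolyharmonicMaass

open MeasureTheory Set

theorem natAbs_cast_eq {R : Type*} [Ring R] (k : ℤ) : (k.natAbs : R) = 2 * k.toNat - k := by
  have h : (k.natAbs : ℤ) = 2 * k.toNat - k := by omega
  have := congrArg (Int.cast : ℤ → R) h
  simpa only [Int.cast_natCast, Int.cast_sub, Int.cast_mul, Int.cast_ofNat] using this

theorem re_add_natCast (s : ℂ) (n : ℕ) : (s + n).re = s.re + n := by simp

theorem re_natCast_add_one_sub (s : ℂ) (n : ℕ) : ((n : ℂ) + 1 - s).re = n + 1 - s.re := by simp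

/-- Treating `h` as one more term, indexed by `none`, means that integrability of the sum of the `F
i` need not be shown separately. -/
theorem tsum_integral_add {α ι : Type*} [MeasurableSpace α] {μ : Measure α} [Countable ι]
    {F : ι → α → ℂ} {h : α → ℂ} (hF : ∀ i, Integrable (F i) μ)
    (hs : Summable fun i => ∫ a, ‖F i a‖ ∂μ) (hsp : ∀ᵐ a ∂μ, Summable fun i => F i a)
    (hh : Integrable h μ) :
    ∑' i, ∫ a, F i a ∂μ + ∫ a, h a ∂μ = ∫ a, (∑' i, F i a + h a) ∂μ := by
  let G : Option ι → α → ℂ := fun o => o.elim h F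
  have hG : ∀ o, Integrable (G o) μ := fun o => by cases o with
    | none => exact hh
    | some i => exact hF i
  have hsome (f : Option ι → ℝ) : Summable (fun i => f (some i)) → Summable f := fun hf => by
    rw [← Equiv.summable_iff (Equiv.optionEquivSumPUnit.{0} ι).symm]
    refine Summable.sum _ ?_ ?_
    · exact hf
    · exact (hasSum_fintype (β := PUnit) _).summable
  have h1 := hasSum_integral_of_summable_integral_norm hG (hsome _ hs)
  have h2 (f : Option ι → ℂ) (hf : Summable fun i => f (some i)) :
      HasSum f (∑' i, f (some i) + f none) := by
    rw [← Equiv.hasSum_iff (Equiv.optionEquivSumPUnit.{0} ι).symm]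
    refine HasSum.sum ?_ ?_
    · exact hf.hasSum
    · exact hasSum_unique _
  have h3 := h2 (fun o => ∫ a, G o a ∂μ) (hasSum_integral_of_summable_integral_norm hF hs).summable
  rw [show ∑' i, ∫ a, F i a ∂μ + ∫ a, h a ∂μ = ∫ a, (∑' o, G o a) ∂μ from h3.unique h1]
  refine integral_congr_ae ?_
  filter_upwards [hsp] with a ha
  exact (h2 (fun o => G o a) ha).tsum_eq

/-- The substitution t ↦ 1/t, obtained from `mellin_comp_inv` for a function cut off to [1,∞). -/
theorem integral_Ioc_eq_integral_Ioi (h : ℝ → ℂ) (S : ℂ) :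
    ∫ t : ℝ in Ioc 0 1, (t : ℂ) ^ (S - 1) * h t =
      ∫ t : ℝ in Ioi 1, (t : ℂ) ^ (-S - 1) * h t⁻¹ := by
  have h1 := mellin_comp_inv ((Ici 1).indicator fun t => h t⁻¹) S
  rw [mellin, mellin] at h1
  have e1 : ∀ t : ℝ, t ∈ Ioi (0 : ℝ) → (t : ℂ) ^ (S - 1) • (Ici 1).indicator (fun t => h t⁻¹) t⁻¹ =
      (Ioc 0 1).indicator (fun t : ℝ => (t : ℂ) ^ (S - 1) * h t) t := by
    intro t ht
    by_cases h' : t ≤ 1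
    · rw [indicator_of_mem (show t⁻¹ ∈ Ici 1 from (one_le_inv₀ ht).2 h'),
        indicator_of_mem (show t ∈ Ioc 0 1 from ⟨ht, h'⟩), inv_inv, smul_eq_mul]
    · rw [indicator_of_notMem (s := Ici (1 : ℝ)) (fun hm => h' ((one_le_inv₀ ht).1 hm)),
        indicator_of_notMem (s := Ioc (0 : ℝ) 1) (fun hm => h' hm.2), smul_zero]
  have e2 : ∀ t : ℝ, t ∈ Ioi (0 : ℝ) → (t : ℂ) ^ (-S - 1) • (Ici 1).indicator (fun t => h t⁻¹) t =
      (Ici 1).indicator (fun t : ℝ => (t : ℂ) ^ (-S - 1) * h t⁻¹) t := by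
    intro t ht
    by_cases h' : t ∈ Ici (1 : ℝ)
    · rw [indicator_of_mem h', indicator_of_mem h', smul_eq_mul]
    · rw [indicator_of_notMem h', indicator_of_notMem h', smul_zero]
  have hsub : Ici (1 : ℝ) ⊆ Ioi 0 := fun t ht => (zero_lt_one' ℝ).trans_le ht
  rw [setIntegral_congr_fun measurableSet_Ioi e1, setIntegral_congr_fun measurableSet_Ioi e2,
    setIntegral_indicator measurableSet_Ioc, setIntegral_indicator measurableSet_Ici,
    inter_eq_self_of_subset_right Ioc_subset_Ioi_self,
    inter_eq_self_of_subset_right hsub,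
    integral_Ici_eq_integral_Ioi] at h1
  exact h1

theorem integral_Ioi_cpow_sub {S : ℂ} (hS : 1 < S.re) :
    IntegrableOn (fun t : ℝ => (t : ℂ) ^ (-S) - (t : ℂ) ^ (-S - 1)) (Ioi 1) ∧
    ∫ t : ℝ in Ioi 1, ((t : ℂ) ^ (-S) - (t : ℂ) ^ (-S - 1)) = 1 / (S - 1) - 1 / S := by
  have h1 : (-S).re < -1 := by simpa using hS
  have h2 : (-S - 1).re < -1 := by simp; linarith
  have i1 := integrableOn_Ioi_cpow_of_lt h1 one_pos
  have i2 := integrableOn_Ioi_cpow_of_lt h2 one_pos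
  refine ⟨i1.sub i2, ?_⟩
  rw [integral_sub i1 i2, integral_Ioi_cpow_of_lt h1 one_pos, integral_Ioi_cpow_of_lt h2 one_pos]
  have h3 : S - 1 ≠ 0 := fun h => by simp [sub_eq_zero.1 h] at hS
  have h4 : S ≠ 0 := fun h => by simp [h] at hS; linarith
  have h5 : -S + 1 ≠ 0 := fun h => h3 (by linear_combination -h)
  simp only [Complex.ofReal_one, Complex.one_cpow, sub_add_cancel]
  field_simp
  ring

/-- The lower part `∫_0^1 t ^ (S - 1) exp (-π x t) dt` of the Gamma integral. -/
noncomputable def lowerGamma (S : ℂ) (x : ℝ) : ℂ :=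
  ∫ t : ℝ in Ioc 0 1, (t : ℂ) ^ (S - 1) * (Real.exp (-(Real.pi * x * t)) : ℂ)

theorem polyDecay_lowerGamma {S : ℂ} (hS : 0 < S.re) : PolyDecay S.re (lowerGamma S) :=
  ⟨_, fun _ hx => (norm_integral_le_integral_norm _).trans
    (integral_norm_Ioc_cpow_mul_exp_le hS hx)⟩

/-- Interchange of sum and integral by absolute convergence. The extra `h` makes room for the
zero-pair terms of the theta functional equation. -/
theorem latticeSum_integral {k : ℤ} {z : ℂ} (hz : 0 < z.im) {S : ℂ} {A C : ℝ} {s : Set ℝ}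
    (hsm : MeasurableSet s) (hs : s ⊆ Ioi 0) (hA : 2 < 2 * (A - k.toNat) + k)
    (hi : ∀ x, 0 < x → IntegrableOn
      (fun t : ℝ => (t : ℂ) ^ (S - 1) * (Real.exp (-(Real.pi * x * t)) : ℂ)) s)
    (hb : ∀ x, 0 < x → ∫ t : ℝ in s, ‖(t : ℂ) ^ (S - 1) * (Real.exp (-(Real.pi * x * t)) : ℂ)‖ ≤
      C * x ^ (-A)) {h : ℝ → ℂ} (hh : IntegrableOn h s) :
    latticeSum k (fun x => (x : ℂ) ^ k.toNat *
      ∫ t : ℝ in s, (t : ℂ) ^ (S - 1) * (Real.exp (-(Real.pi * x * t)) : ℂ)) z +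
      ∫ t in s, h t =
    ∫ t : ℝ in s, ((t : ℂ) ^ (S - 1) *
      latticeSum k (fun x => (x : ℂ) ^ k.toNat * expPi t x) z + h t) := by
  have hC : 0 ≤ C := by
    have := hb 1 one_pos
    rw [Real.one_rpow, mul_one C] at this
    exact le_trans (integral_nonneg fun _ => norm_nonneg _) this
  let F : {p : ℤ × ℤ // p ≠ 0} → ℝ → ℂ := fun p t =>
    (lin p.1 z ^ (-k) * (quad p.1 z : ℂ) ^ k.toNat) *
      ((t : ℂ) ^ (S - 1) * (Real.exp (-(Real.pi * quad p.1 z * t)) : ℂ))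
  have hF : ∀ p, IntegrableOn (F p) s := fun p => (hi _ (quad_pos p.2 hz)).const_mul _
  have hsum : Summable fun p => ∫ t in s, ‖F p t‖ := by
    refine Summable.of_nonneg_of_le (fun p => integral_nonneg fun _ => norm_nonneg _) (fun p => ?_)
      ((summable_latticeSum_norm hA hz).mul_left C)
    have hq := quad_pos p.2 hz
    simp only [F]
    simp_rw [norm_mul (lin p.1 z ^ (-k) * _)]
    rw [integral_const_mul, norm_mul, norm_pow, Complex.norm_real, Real.norm_of_nonneg hq.le]
    calc _ ≤ ‖lin p.1 z ^ (-k)‖ * quad p.1 z ^ k.toNat * (C * quad p.1 z ^ (-A)) := by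
          gcongr
          exact hb _ hq
      _ = _ := by
          rw [neg_sub, sub_eq_neg_add, Real.rpow_add hq, Real.rpow_natCast]
          ring
  have hpt : ∀ t ∈ s, Summable fun p => F p t := by
    intro t ht
    -- The summand `k.toNat` absorbs the power of `quad`; the remaining `k.natAbs + 2` secures
    -- convergence in weight `k`.
    have h1 := ((polyDecay_expPi (hs ht) (k.toNat + (k.natAbs + 2))).zpow_mul (B := k.natAbs + 2)
      (k.toNat : ℤ) (by push_cast; ring)).summable (k := k) (by
        rw [Nat.cast_natAbs, Int.cast_abs]
        linarith [neg_abs_le (k : ℝ), abs_nonneg (k : ℝ)]) hz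
    refine (h1.mul_left ((t : ℂ) ^ (S - 1))).congr fun p => ?_
    simp only [F, expPi, zpow_natCast]
    ring
  have key := tsum_integral_add (μ := volume.restrict s) hF hsum
    ((ae_restrict_mem hsm).mono hpt) hh
  have e1 : latticeSum k (fun x => (x : ℂ) ^ k.toNat *
      ∫ t : ℝ in s, (t : ℂ) ^ (S - 1) * (Real.exp (-(Real.pi * x * t)) : ℂ)) z =
      ∑' p, ∫ t in s, F p t :=
    tsum_congr fun p => by simp only [F]; rw [integral_const_mul]; ring
  rw [e1, key]
  refine integral_congr_ae (Eventually.of_forall fun t => ?_)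
  simp only
  rw [latticeSum, ← tsum_mul_left]
  congr 1
  refine tsum_congr fun p => ?_
  simp only [F, expPi]
  ring

/-- Substitute t ↦ 1/t and apply the theta functional equation. In weight 0 the zero pair leaves t -
1, whose integral against t^(-S-1) gives the two polar terms. -/
theorem latticeSum_lowerGamma {k : ℤ} (hk : Even k) {z : ℂ} (hz : 0 < z.im) {S : ℂ}
    (hS : 1 + (k.natAbs : ℝ) / 2 < S.re) :
    latticeSum k (fun x => (x : ℂ) ^ k.toNat * lowerGamma S x) z =
      latticeSum k (fun x => (x : ℂ) ^ k.toNat * incGamma (k.natAbs + 1 - S) x) z +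
        (if k = 0 then 1 / (S - 1) - 1 / S else 0) := by
  have hkk : (k.natAbs : ℝ) = 2 * k.toNat - k := natAbs_cast_eq k
  have hS0 : 0 < S.re := by
    have : (0 : ℝ) ≤ (k.natAbs : ℝ) / 2 := by positivity
    linarith
  have hA : 2 < 2 * (S.re - k.toNat) + k := by linarith
  have h1 := latticeSum_integral (k := k) hz (h := 0) (A := S.re) measurableSet_Ioc
    Ioc_subset_Ioi_self hA (fun x hx => integrableOn_Ioc_cpow_mul_exp hS0 hx)
    (fun x hx => integral_norm_Ioc_cpow_mul_exp_le hS0 hx) (integrable_zero _ _ _)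
  simp only [Pi.zero_apply, integral_zero, add_zero] at h1
  have hA' : (2 : ℝ) < 2 * ((|(k.natAbs + 1 - S).re| + k.natAbs + 2) - k.toNat) + k := by
    have := abs_nonneg (k.natAbs + 1 - S : ℂ).re
    have h' : (0 : ℝ) ≤ k.natAbs := by positivity
    linarith
  have h2 := latticeSum_integral (k := k) hz (S := k.natAbs + 1 - S)
    (h := fun t => if k = 0 then (t : ℂ) ^ (-S) - (t : ℂ) ^ (-S - 1) else 0) measurableSet_Ioi
    (Ioi_subset_Ioi zero_le_one) hA' (fun x hx => integrableOn_incGamma _ hx)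
    (fun x hx => integral_norm_incGamma_le (by positivity)
      (by linarith [le_abs_self (k.natAbs + 1 - S : ℂ).re, Nat.cast_nonneg (α := ℝ) k.natAbs]) hx) (by
        split_ifs with h0
        · subst h0
          exact (integral_Ioi_cpow_sub (by simpa using hS)).1
        · exact integrable_zero _ _ _)
  have h3 : ∫ t : ℝ in Ioi 1, (if k = 0 then (t : ℂ) ^ (-S) - (t : ℂ) ^ (-S - 1) else 0) =
      if k = 0 then 1 / (S - 1) - 1 / S else 0 := by
    split_ifs with h0
    · subst h0
      exact (integral_Ioi_cpow_sub (by simpa using hS)).2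
    · simp
  rw [h3] at h2
  simp only [lowerGamma, incGamma]
  rw [h1, h2, integral_Ioc_eq_integral_Ioi]
  refine setIntegral_congr_fun measurableSet_Ioi fun t ht => ?_
  have ht0 : (0 : ℝ) < t := zero_lt_one.trans ht
  have ht' : (t : ℂ) ≠ 0 := by exact_mod_cast ht0.ne'
  have h4 := eq_sub_of_add_eq (theta_functional_equation hk ht0 hz)
  rw [h4]
  have e1 : (t : ℂ) ^ ((k.natAbs : ℂ) + 1 - S - 1) = (t : ℂ) ^ (-S - 1) * (t : ℂ) ^ (k.natAbs + 1) := by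
    rw [← Complex.cpow_natCast, ← Complex.cpow_add _ _ ht']
    congr 1
    push_cast
    ring
  have e2 : (t : ℂ) ^ (-S) = (t : ℂ) ^ (-S - 1) * t := by
    rw [Complex.cpow_sub _ _ ht', Complex.cpow_one, div_mul_cancel₀ _ ht']
  rw [e1, e2]
  split_ifs with h0
  · subst h0
    simp
    ring
  · ring

/-! ### The expansion valid for all s -/

/-- The radial function in the rapidly convergent expansion of the completed Eisenstein series. -/
noncomputable def kernel (k : ℤ) (s : ℂ) (x : ℝ) : ℂ :=
  (x : ℂ) ^ k.toNat *
    (incGamma (s + k.toNat) x + incGamma (k.natAbs + 1 - (s + k.toNat)) x)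

/-- The entire part of the completed Eisenstein series. -/
noncomputable def entirePart (k : ℤ) (s : ℂ) (z : ℂ) : ℂ :=
  (1 / 2 : ℂ) * (Real.pi : ℂ) ^ ((k.natAbs : ℂ) / 2) * latticeSum k (kernel k s) z

/-- The polar part of the completed Eisenstein series. -/
noncomputable def polarPart (k : ℤ) (s : ℂ) : ℂ :=
  if k = 0 then (1 / 2 : ℂ) * (1 / (s - 1) - 1 / s) else 0

theorem polyDecay_kernel (k : ℤ) {s : ℂ} {A : ℝ} (hA : ‖s‖ + 2 * k.natAbs + 1 ≤ A) :
    PolyDecay (A - k.toNat) (kernel k s) := by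
  have h1 := Complex.abs_re_le_norm s
  have h2 := abs_le.1 h1
  have h3 : (0 : ℝ) ≤ k.natAbs := by positivity
  have h4 : (0 : ℝ) ≤ k.toNat := by positivity
  have h5 : (k.toNat : ℝ) ≤ k.natAbs := by exact_mod_cast (by omega : k.toNat ≤ k.natAbs)
  have h6 := norm_nonneg s
  have := ((polyDecay_incGamma (S := s + k.toNat) (A := A) (by linarith) (by simp only [re_add_natCast]; linarith)).add
    (polyDecay_incGamma (S := k.natAbs + 1 - (s + k.toNat)) (A := A) (by linarith)
      (by simp only [re_natCast_add_one_sub, re_add_natCast]; linarith))).zpow_mul (B := A - k.toNat) k.toNat (by rw [Int.cast_natCast])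
  exact this.congr fun x hx => by rw [kernel, zpow_natCast]

/-- The argument of the Gamma factor is exactly S = s + max(k,0), and Re s > 1 - k/2 is the
condition Re S > 1 + |k|/2 under which the lower integral can be folded. -/
theorem completedEisensteinSeries_eq {k : ℤ} (hk : Even k) (z : ℍ) {s : ℂ}
    (hs : 1 - (k : ℝ) / 2 < s.re) :
    completedEisensteinSeries k z s = entirePart k s z + polarPart k s := by
  have hz : 0 < (z : ℂ).im := z.im_pos
  have hkk : (k.natAbs : ℝ) = 2 * k.toNat - k := natAbs_cast_eq k
  have hkc : (k.natAbs : ℂ) = 2 * k.toNat - k := natAbs_cast_eq k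
  set S : ℂ := s + k.toNat with hSdef
  have hS : 1 + (k.natAbs : ℝ) / 2 < S.re := by rw [hSdef, re_add_natCast]; linarith
  have hS0 : 0 < S.re := by
    have : (0 : ℝ) ≤ (k.natAbs : ℝ) / 2 := by positivity
    linarith
  have hpi : (Real.pi : ℂ) ≠ 0 := by exact_mod_cast Real.pi_ne_zero
  have e1 : eisensteinSeries k z s =
      (1 / 2 : ℂ) * latticeSum k (fun x => (x : ℂ) ^ k.toNat * (x : ℂ) ^ (-S)) z := by
    rw [eisensteinSeries, latticeSum]
    congr 1
    refine tsum_congr fun p => ?_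
    have hq := quad_pos p.2 hz
    have hq' : (quad p.1 z : ℂ) ≠ 0 := by exact_mod_cast hq.ne'
    have hl := norm_pos_iff.2 (lin_ne_zero p.2 hz)
    have e : (quad p.1 z : ℂ) ^ k.toNat * (quad p.1 z : ℂ) ^ (-S) = (quad p.1 z : ℂ) ^ (-s) := by
      rw [← Complex.cpow_natCast, ← Complex.cpow_add _ _ hq', hSdef]
      congr 1
      ring
    rw [e, quad, Complex.normSq_eq_norm_sq, Complex.cpow_neg, div_eq_mul_inv _ (z : ℂ).im,
      Complex.ofReal_mul, Complex.mul_cpow_ofReal_nonneg (by positivity) (by positivity),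
      mul_inv, Complex.ofReal_inv, Complex.inv_cpow _ _ (by
        rw [Complex.arg_ofReal_of_nonneg hz.le]; exact Real.pi_pos.ne), inv_inv, sq,
      Complex.ofReal_mul, Complex.mul_cpow_ofReal_nonneg hl.le hl.le, two_mul,
      Complex.cpow_add _ _ (by exact_mod_cast hl.ne'), zpow_neg]
    simp only [lin, UpperHalfPlane.coe_im]
    field_simp
  have hd1 : PolyDecay (S.re - k.toNat) fun x => (x : ℂ) ^ k.toNat * incGamma S x :=
    ((polyDecay_incGamma hS0 le_rfl).zpow_mul (B := S.re - k.toNat) k.toNat (by rw [Int.cast_natCast])).congr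
      fun x _ => by rw [zpow_natCast]
  have hd2 : PolyDecay (S.re - k.toNat) fun x => (x : ℂ) ^ k.toNat * lowerGamma S x :=
    ((polyDecay_lowerGamma hS0).zpow_mul (B := S.re - k.toNat) k.toNat (by rw [Int.cast_natCast])).congr
      fun x _ => by rw [zpow_natCast]
  have hd3 : PolyDecay (S.re - k.toNat) fun x => (x : ℂ) ^ k.toNat *
      incGamma (k.natAbs + 1 - S) x :=
    ((polyDecay_incGamma (S := k.natAbs + 1 - S) (A := S.re) hS0
      (by simp only [re_natCast_add_one_sub]; linarith)).zpow_mul (B := S.re - k.toNat) k.toNat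
      (by rw [Int.cast_natCast])).congr fun x _ => by rw [zpow_natCast]
  have hA : 2 < 2 * (S.re - k.toNat) + k := by linarith
  have e2 : (Real.pi : ℂ) ^ (-S) * Complex.Gamma S *
      latticeSum k (fun x => (x : ℂ) ^ k.toNat * (x : ℂ) ^ (-S)) z =
      latticeSum k (kernel k s) z + (if k = 0 then 1 / (S - 1) - 1 / S else 0) := by
    have : latticeSum k (kernel k s) z = latticeSum k (fun x => (x : ℂ) ^ k.toNat * incGamma S x +
        (x : ℂ) ^ k.toNat * incGamma (k.natAbs + 1 - S) x) z :=
      latticeSum_congr (fun x _ => by rw [kernel, mul_add]) hz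
    rw [this, latticeSum_add hd1 hd3 hA hz, add_assoc, ← latticeSum_lowerGamma hk hz hS,
      ← latticeSum_add hd1 hd2 hA hz, ← latticeSum_const_mul]
    refine latticeSum_congr (fun x hx => ?_) hz
    rw [mul_left_comm, Gamma_mul_cpow_eq_incGamma_add hS0 hx, mul_add]
    rfl
  have e3 : (Real.pi : ℂ) ^ (-(s + (k : ℂ) / 2)) =
      (Real.pi : ℂ) ^ ((k.natAbs : ℂ) / 2) * (Real.pi : ℂ) ^ (-S) := by
    rw [← Complex.cpow_add _ _ hpi, hkc]
    congr 1
    rw [hSdef]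
    ring
  have e4 : s + (k : ℂ) / 2 + ((|k| : ℤ) : ℂ) / 2 = S := by
    have : ((|k| : ℤ) : ℂ) = k.natAbs := by rw [← Int.natCast_natAbs]; simp
    rw [this, hkc, hSdef]
    ring
  rw [completedEisensteinSeries, e1, e3, e4, entirePart]
  calc _ = (1 / 2 : ℂ) * (Real.pi : ℂ) ^ ((k.natAbs : ℂ) / 2) *
        ((Real.pi : ℂ) ^ (-S) * Complex.Gamma S *
          latticeSum k (fun x => (x : ℂ) ^ k.toNat * (x : ℂ) ^ (-S)) z) := by ring
    _ = _ := by
      rw [e2, mul_add, polarPart]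
      congr 1
      split_ifs with h0
      · subst h0
        simp [hSdef]
      · simp

theorem differentiable_entirePart (k : ℤ) {z : ℂ} (hz : 0 < z.im) :
    Differentiable ℂ fun s => entirePart k s z := by
  refine Differentiable.const_mul ?_ _
  intro s₀
  -- Large enough that, throughout the unit ball about `s₀`, `A` exceeds the real parts of both
  -- incomplete Gamma parameters, and that the majorant converges in weight `k`.
  set A : ℝ := ‖s₀‖ + 4 * k.natAbs + 3 with hA
  have h3 : (0 : ℝ) ≤ k.natAbs := by positivity
  have h4 : (0 : ℝ) ≤ k.toNat := by positivity
  have h5 : (k.toNat : ℝ) ≤ k.natAbs := by exact_mod_cast (by omega : k.toNat ≤ k.natAbs)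
  have h6 := norm_nonneg s₀
  have h7 : -(k.natAbs : ℝ) ≤ k := by exact_mod_cast (by omega : -(k.natAbs : ℤ) ≤ k)
  have hA0 : 0 < A := by linarith
  have hs := summable_latticeSum_norm (k := k) (A := A - k.toNat) (by linarith) hz
  have hd : DifferentiableOn ℂ (fun s => latticeSum k (kernel k s) z) (Metric.ball s₀ 1) := by
    refine Complex.differentiableOn_tsum_of_summable_norm
      (hs.mul_left (2 * (Real.Gamma A * Real.pi ^ (-A)))) (fun p => ?_) Metric.isOpen_ball
      fun p s hs => ?_
    · have hq := quad_pos p.2 hz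
      refine Differentiable.differentiableOn ?_
      unfold kernel
      have hg := differentiable_incGamma hq
      exact (((hg.comp (differentiable_id.add_const _)).add
        (hg.comp ((differentiable_id.add_const _).const_sub _))).const_mul _).const_mul _
    · have hq := quad_pos p.2 hz
      have h8 : ‖s‖ ≤ ‖s₀‖ + 1 := by
        have h9 : ‖s - s₀‖ < 1 := by simpa [dist_eq_norm] using hs
        have := norm_add_le (s - s₀) s₀
        rw [sub_add_cancel] at this
        linarith
      have h10 := abs_le.1 (Complex.abs_re_le_norm s)
      have b1 := norm_incGamma_le (S := s + k.toNat) hA0 (by simp only [re_add_natCast]; linarith) hq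
      have b2 := norm_incGamma_le (S := k.natAbs + 1 - (s + k.toNat)) hA0 (by simp only [re_natCast_add_one_sub, re_add_natCast]; linarith) hq
      rw [kernel, norm_mul, norm_mul, norm_pow, Complex.norm_real, Real.norm_of_nonneg hq.le]
      calc _ ≤ ‖lin p.1 z ^ (-k)‖ * (quad p.1 z ^ k.toNat *
            (Real.Gamma A * Real.pi ^ (-A) * quad p.1 z ^ (-A) +
              Real.Gamma A * Real.pi ^ (-A) * quad p.1 z ^ (-A))) := by
            gcongr
            exact (norm_add_le _ _).trans (add_le_add b1 b2)
        _ = _ := by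
            rw [neg_sub, sub_eq_neg_add, Real.rpow_add hq, Real.rpow_natCast]
            ring
  exact hd.differentiableAt (Metric.isOpen_ball.mem_nhds (Metric.mem_ball_self one_pos))

end PolyharmonicMaass

/-! ### The action of ξ on the entire part -/

namespace PolyharmonicMaass

theorem realDifferentiableAt_of_eq {f : ℍ → ℂ} {F : ℂ → ℂ} (hf : ∀ w : ℍ, f w = F w) {z : ℍ}
    (hF : DifferentiableAt ℝ F z) : RealDifferentiableAt f z := by
  refine hF.congr_of_eventuallyEq ?_
  filter_upwards [(isOpen_lt continuous_const Complex.continuous_im).mem_nhds z.im_pos] with w hw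
  rw [hf, UpperHalfPlane.ofComplex_apply_of_im_pos hw]

theorem xi_of_eq {f : ℍ → ℂ} {F : ℂ → ℂ} (hf : ∀ w : ℍ, f w = F w) (k : ℤ) {z : ℍ} {W : ℂ}
    (hF : fderiv ℝ F z 1 + Complex.I * fderiv ℝ F z Complex.I =
      -Complex.I / ((z.im : ℝ) : ℂ) ^ 2 * W) :
    xi k f z = -((z.im : ℝ) : ℂ) ^ (k - 2) * conj W := by
  have he : (fun w : ℂ => f (UpperHalfPlane.ofComplex w)) =ᶠ[𝓝 (z : ℂ)] F := by
    filter_upwards [(isOpen_lt continuous_const Complex.continuous_im).mem_nhds z.im_pos] with w hw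
    rw [hf, UpperHalfPlane.ofComplex_apply_of_im_pos hw]
  have hy : ((z.im : ℝ) : ℂ) ≠ 0 := by exact_mod_cast z.im_pos.ne'
  rw [xi, wirtingerBar, he.fderiv_eq, hF, zpow_sub₀ hy]
  simp only [map_mul, map_div₀, map_neg, map_pow, Complex.conj_I, Complex.conj_ofReal, map_one,
    map_ofNat]
  rw [show ((z.im : ℝ) : ℂ) ^ (2 : ℤ) = ((z.im : ℝ) : ℂ) ^ 2 from zpow_ofNat _ _]
  field_simp
  linear_combination (conj W) * Complex.I_sq

/-- The derivative of `kernel`. -/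
noncomputable def kernelDeriv (k : ℤ) (s : ℂ) (x : ℝ) : ℂ :=
  (k.toNat : ℂ) * ((x : ℂ) ^ ((k.toNat : ℤ) - 1) *
    (incGamma (s + k.toNat) x + incGamma (k.natAbs + 1 - (s + k.toNat)) x)) +
  -(Real.pi : ℂ) * ((x : ℂ) ^ (k.toNat : ℤ) *
    (incGamma (s + k.toNat + 1) x + incGamma (k.natAbs + 1 - (s + k.toNat) + 1) x))

theorem hasDerivAt_kernel (k : ℤ) (s : ℂ) {x : ℝ} (hx : 0 < x) :
    HasDerivAt (kernel k s) (kernelDeriv k s x) x := by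
  have hx' : (x : ℂ) ≠ 0 := by exact_mod_cast hx.ne'
  have h1 : HasDerivAt (fun x : ℝ => (x : ℂ) ^ (k.toNat : ℤ))
      ((k.toNat : ℂ) * (x : ℂ) ^ ((k.toNat : ℤ) - 1)) x := by
    have := (hasDerivAt_zpow (k.toNat : ℤ) (x : ℂ) (Or.inl hx')).comp_ofReal
    rwa [Int.cast_natCast] at this
  have h := h1.mul ((hasDerivAt_incGamma (s + k.toNat) hx).add
    (hasDerivAt_incGamma (k.natAbs + 1 - (s + k.toNat)) hx))
  have he : kernel k s = (fun x : ℝ => (x : ℂ) ^ (k.toNat : ℤ)) *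
      (incGamma (s + k.toNat) + incGamma (k.natAbs + 1 - (s + k.toNat))) := by
    funext x
    simp only [Pi.mul_apply, Pi.add_apply, zpow_natCast, kernel]
  rw [he]
  refine h.congr_deriv ?_
  simp only [Pi.add_apply]
  rw [kernelDeriv]
  ring

theorem polyDecay_kernelDeriv (k : ℤ) {s : ℂ} {A : ℝ} (hA : ‖s‖ + 2 * k.natAbs + 1 ≤ A) :
    PolyDecay (A - k.toNat + 1) (kernelDeriv k s) := by
  have h2 := abs_le.1 (Complex.abs_re_le_norm s)
  have h3 : (0 : ℝ) ≤ k.natAbs := by positivity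
  have h4 : (0 : ℝ) ≤ k.toNat := by positivity
  have h5 : (k.toNat : ℝ) ≤ k.natAbs := by exact_mod_cast (by omega : k.toNat ≤ k.natAbs)
  have h6 := norm_nonneg s
  have hA0 : 0 < A := by linarith
  have e1 : (s + k.toNat).re ≤ A := by rw [re_add_natCast]; linarith
  have e2 : (k.natAbs + 1 - (s + k.toNat)).re ≤ A := by
    rw [re_natCast_add_one_sub, re_add_natCast]; linarith
  have d1 := (polyDecay_incGamma hA0 e1).add (polyDecay_incGamma hA0 e2)
  have d2 := (polyDecay_incGamma (S := s + k.toNat + 1) (A := A + 1) (by linarith)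
    (by rw [Complex.add_re, Complex.one_re]; linarith)).add
    (polyDecay_incGamma (S := k.natAbs + 1 - (s + k.toNat) + 1) (A := A + 1) (by linarith)
    (by rw [Complex.add_re, Complex.one_re]; linarith))
  exact ((d1.zpow_mul ((k.toNat : ℤ) - 1)
    (by rw [Int.cast_sub, Int.cast_natCast, Int.cast_one]; ring)).const_mul _).add
    ((d2.zpow_mul (k.toNat : ℤ) (by rw [Int.cast_natCast]; ring)).const_mul _)

theorem latticeSum_kernel_wirtinger (k : ℤ) (s : ℂ) {z : ℂ} (hz : 0 < z.im) :
    DifferentiableAt ℝ (latticeSum k (kernel k s)) z ∧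
    fderiv ℝ (latticeSum k (kernel k s)) z 1 +
      Complex.I * fderiv ℝ (latticeSum k (kernel k s)) z Complex.I =
      -Complex.I / (z.im : ℂ) ^ 2 * latticeSum (k - 2) (kernelDeriv k s) z := by
  set A : ℝ := ‖s‖ + 4 * k.natAbs + 3 with hA
  have h3 : (0 : ℝ) ≤ k.natAbs := by positivity
  have h5 : (k.toNat : ℝ) ≤ k.natAbs := by exact_mod_cast (by omega : k.toNat ≤ k.natAbs)
  have h6 := norm_nonneg s
  have h7 : -(k.natAbs : ℝ) ≤ k := by exact_mod_cast (by omega : -(k.natAbs : ℤ) ≤ k)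
  exact (polyDecay_kernel k (A := A) (by linarith)).wirtinger
    (polyDecay_kernelDeriv k (by linarith)) (by linarith) (fun x hx => hasDerivAt_kernel k s hx) hz

theorem differentiableAt_entirePart (k : ℤ) (s : ℂ) {z : ℂ} (hz : 0 < z.im) :
    DifferentiableAt ℝ (entirePart k s) z :=
  (latticeSum_kernel_wirtinger k s hz).1.const_mul _

/-- ∂/∂z̄ leads to weight k-2, conjugation to weight 2-k, and the powers of y cancel. The constant
in front is real. -/
theorem xi_entirePart (k : ℤ) (s : ℂ) (z : ℍ) :
    xi k (fun w => entirePart k s w) z =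
      (1 / 2 : ℂ) * (Real.pi : ℂ) ^ ((k.natAbs : ℂ) / 2) *
        latticeSum (2 - k) (fun x => -((x : ℂ) ^ (2 - k) * conj (kernelDeriv k s x))) z := by
  obtain ⟨hd, hw⟩ := latticeSum_kernel_wirtinger k s (z := z) z.im_pos
  set c : ℂ := (1 / 2 : ℂ) * (Real.pi : ℂ) ^ ((k.natAbs : ℂ) / 2) with hc
  have hcc : conj c = c := by
    have : c = ((1 / 2 * Real.pi ^ ((k.natAbs : ℝ) / 2) : ℝ) : ℂ) := by
      rw [hc, Complex.ofReal_mul, Complex.ofReal_cpow Real.pi_pos.le]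
      push_cast
      rfl
    rw [this, Complex.conj_ofReal]
  have hy : ((z.im : ℝ) : ℂ) ≠ 0 := by exact_mod_cast z.im_pos.ne'
  have h := xi_of_eq (f := fun w => entirePart k s w) (F := entirePart k s) (fun _ => rfl) k (z := z)
    (W := c * latticeSum (k - 2) (kernelDeriv k s) z) (by
      have : entirePart k s = fun w => c * latticeSum k (kernel k s) w := rfl
      rw [this, fderiv_const_mul hd]
      simp only [smul_apply, smul_eq_mul]
      rw [mul_left_comm, ← mul_add, hw, UpperHalfPlane.coe_im]
      ring)
  rw [h, map_mul, hcc, latticeSum_conj _ _ z.im_pos, UpperHalfPlane.coe_im, neg_sub]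
  have e : ((z.im : ℝ) : ℂ) ^ (k - 2) * ((z.im : ℝ) : ℂ) ^ (2 - k) = 1 := by
    rw [← zpow_add₀ hy]
    simp
  have e2 : latticeSum (2 - k) (fun x => -((x : ℂ) ^ (2 - k) * conj (kernelDeriv k s x))) z =
      -latticeSum (2 - k) (fun x => (x : ℂ) ^ (2 - k) * conj (kernelDeriv k s x)) z := by
    rw [← neg_one_mul, ← latticeSum_const_mul]
    simp only [neg_one_mul]
  rw [e2]
  linear_combination (-c * latticeSum (2 - k)
    (fun x => (x : ℂ) ^ (2 - k) * conj (kernelDeriv k s x)) z) * e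

/-- For k ≤ 0 the kernel carries no power of x, so differentiation only shifts both parameters by
one. The shifted pair is the pair for (2-k, -s̄) in the opposite order, and the factor π adjusts the
power of π. -/
theorem xi_entirePart_of_nonpos {k : ℤ} (hk : k ≤ 0) (s : ℂ) (z : ℍ) :
    xi k (fun w => entirePart k s w) z = entirePart (2 - k) (-conj s) z := by
  obtain ⟨n, rfl⟩ : ∃ n : ℕ, k = -n := ⟨k.natAbs, by omega⟩
  have h1 : (-(n : ℤ)).toNat = 0 := by omega
  have h2 : (-(n : ℤ)).natAbs = n := by omega
  have h3 : (2 - -(n : ℤ)).toNat = n + 2 := by omega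
  have h4 : (2 - -(n : ℤ)).natAbs = n + 2 := by omega
  have h5 : 2 - -(n : ℤ) = ((n + 2 : ℕ) : ℤ) := by push_cast; ring
  have hpi : (Real.pi : ℂ) ≠ 0 := by exact_mod_cast Real.pi_ne_zero
  have e : latticeSum (2 - -(n : ℤ)) (fun x => -((x : ℂ) ^ (2 - -(n : ℤ)) *
      conj (kernelDeriv (-(n : ℤ)) s x))) z =
      Real.pi * latticeSum (2 - -(n : ℤ)) (kernel (2 - -(n : ℤ)) (-conj s)) z := by
    rw [← latticeSum_const_mul]
    refine latticeSum_congr (fun x hx => ?_) z.im_pos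
    rw [kernelDeriv, kernel, h1, h2, h3, h4, h5, zpow_natCast]
    simp only [map_add, map_mul, incGamma_conj, map_neg, Complex.conj_ofReal, Nat.cast_zero,
      zero_mul, zero_add, zpow_zero, one_mul, map_sub, map_natCast, map_one, add_zero]
    have a1 : (n : ℂ) + 1 - conj s + 1 = -conj s + (n + 2 : ℕ) := by push_cast; ring
    have a2 : conj s + 1 = (n + 2 : ℕ) + 1 - (-conj s + (n + 2 : ℕ)) := by push_cast; ring
    rw [a1, a2]
    ring
  rw [xi_entirePart, e, entirePart, h2, h4]
  have e2 : (Real.pi : ℂ) ^ (((n + 2 : ℕ) : ℂ) / 2) = (Real.pi : ℂ) ^ ((n : ℂ) / 2) * Real.pi := by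
    rw [show ((n + 2 : ℕ) : ℂ) / 2 = (n : ℂ) / 2 + 1 by push_cast; ring, Complex.cpow_add _ _ hpi,
      Complex.cpow_one]
  rw [e2]
  ring

/-- For t > 1/2 the differentiated terms are dominated by their exponentials at t = 1/2. -/
theorem hasDerivAt_theta {k : ℤ} {z : ℂ} (hz : 0 < z.im) :
    HasDerivAt (fun t => latticeSum k (expPi t) z)
      (latticeSum k (fun x => -(Real.pi * x) * expPi 1 x) z) 1 := by
  have hk : (2 : ℝ) < 2 * ((k.natAbs + 2 : ℕ) : ℝ) + k := by
    rw [Nat.cast_add, Nat.cast_natAbs, Int.cast_abs]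
    push_cast
    linarith [neg_abs_le (k : ℝ), abs_nonneg (k : ℝ)]
  have hd : PolyDecay (k.natAbs + 2 : ℕ) fun x => Real.pi * ((x : ℂ) ^ (1 : ℤ) * expPi (1 / 2) x) :=
    ((polyDecay_expPi (t := 1 / 2) (by norm_num) (k.natAbs + 2 + 1)).zpow_mul 1
      (by push_cast; ring)).const_mul _
  have hsum := (hd.summable hk hz).norm
  have hsum1 := (polyDecay_expPi one_pos (k.natAbs + 2)).summable hk hz
  have hdt : ∀ (p : {p : ℤ × ℤ // p ≠ 0}) (t : ℝ), t ∈ Set.Ioi (1 / 2 : ℝ) →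
      HasDerivAt (fun t : ℝ => lin p.1 z ^ (-k) * expPi t (quad p.1 z))
        (lin p.1 z ^ (-k) * (-(Real.pi * quad p.1 z) * expPi t (quad p.1 z))) t := by
    intro p t _
    have h1 : HasDerivAt (fun t : ℝ => Real.exp (-(Real.pi * quad p.1 z * t)))
        (Real.exp (-(Real.pi * quad p.1 z * t)) * -(Real.pi * quad p.1 z)) t := by
      simpa using (((hasDerivAt_id t).const_mul (Real.pi * quad p.1 z)).neg).exp
    refine (h1.ofReal_comp.const_mul _).congr_deriv ?_
    rw [expPi]
    push_cast
    ring
  have hbt : ∀ (p : {p : ℤ × ℤ // p ≠ 0}) (t : ℝ), t ∈ Set.Ioi (1 / 2 : ℝ) →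
      ‖lin p.1 z ^ (-k) * (-(Real.pi * quad p.1 z) * expPi t (quad p.1 z))‖ ≤
      ‖lin p.1 z ^ (-k) * (Real.pi * ((quad p.1 z : ℂ) ^ (1 : ℤ) * expPi (1 / 2) (quad p.1 z)))‖ := by
    intro p t ht
    have hq := quad_pos p.2 hz
    rw [norm_mul, norm_mul (lin p.1 z ^ (-k))]
    refine mul_le_mul_of_nonneg_left ?_ (norm_nonneg _)
    rw [zpow_one, ← mul_assoc, norm_mul, norm_mul _ (expPi (1 / 2) _), norm_neg]
    refine mul_le_mul_of_nonneg_left ?_ (norm_nonneg _)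
    rw [expPi, expPi, Complex.norm_real, Complex.norm_real, Real.norm_of_nonneg (Real.exp_pos _).le,
      Real.norm_of_nonneg (Real.exp_pos _).le]
    have : (1 / 2 : ℝ) ≤ t := le_of_lt ht
    gcongr
  have h1 : (1 : ℝ) ∈ Set.Ioi (1 / 2 : ℝ) := Set.mem_Ioi.2 (by norm_num)
  exact hasDerivAt_tsum_of_isPreconnected hsum isOpen_Ioi isPreconnected_Ioi hdt hbt h1 hsum1 h1

/-- Differentiating θ(1/t) = t^(k-1) θ(t) at t = 1 in weight 2-k gives (1-k) θ(1) - 2 θ'(1) = 0. The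
zero pair contributes to θ(1) only for k = 2. -/
theorem latticeSum_boundary {k : ℤ} (hk : Even k) (hk2 : 2 ≤ k) {z : ℂ} (hz : 0 < z.im) :
    latticeSum (2 - k) (fun x => (1 - k + 2 * (Real.pi * x)) * expPi 1 x) z =
      if k = 2 then 1 else 0 := by
  obtain ⟨n, rfl⟩ : ∃ n : ℕ, k = n + 2 := ⟨(k - 2).toNat, by omega⟩
  have h1 : (2 - ((n : ℤ) + 2)).toNat = 0 := by omega
  have h2 : (2 - ((n : ℤ) + 2)).natAbs = n := by omega
  set K : ℤ := 2 - ((n : ℤ) + 2) with hK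
  have hKe : Even K := even_two.sub hk
  set δ : ℂ := if (n : ℤ) + 2 = 2 then 1 else 0 with hδ
  have hδ' : (if K = 0 then 1 else 0 : ℂ) = δ := by
    have : K = 0 ↔ (n : ℤ) + 2 = 2 := by omega
    simp only [this, hδ]
  set f : ℝ → ℂ := fun t => latticeSum K (expPi t) z with hf
  set d := latticeSum K (fun x => -(Real.pi * x) * expPi 1 x) z with hd
  have hder : HasDerivAt f d 1 := hasDerivAt_theta hz
  have hfe : (fun t : ℝ => f t⁻¹ + δ) =ᶠ[𝓝 1] fun t => (t : ℂ) ^ (n + 1) * (f t + δ) := by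
    filter_upwards [Ioi_mem_nhds (zero_lt_one' ℝ)] with t ht
    have := theta_functional_equation hKe ht hz
    simpa only [h1, h2, pow_zero, one_mul, hδ'] using this
  have hl : HasDerivAt (fun t : ℝ => f t⁻¹ + δ) (-d) 1 := by
    have hi : HasDerivAt (fun t : ℝ => t⁻¹) (-1) (1 : ℝ) := by
      simpa using hasDerivAt_inv (one_ne_zero' ℝ)
    have h := HasDerivAt.scomp (h := fun t : ℝ => t⁻¹) (1 : ℝ) (by rw [inv_one]; exact hder) hi
    simpa using h.add_const δ
  have hr : HasDerivAt (fun t : ℝ => (t : ℂ) ^ (n + 1) * (f t + δ)) ((n + 1) * (f 1 + δ) + d) 1 := by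
    have hp : HasDerivAt (fun t : ℝ => (t : ℂ) ^ (n + 1)) ((n + 1 : ℕ) : ℂ) 1 := by
      have := (hasDerivAt_pow (n + 1) ((1 : ℝ) : ℂ)).comp_ofReal
      simpa using this
    refine (hp.mul (hder.add_const δ)).congr_deriv ?_
    simp
  have hu := hl.unique (hr.congr_of_eventuallyEq hfe)
  have hdec : (2 : ℝ) < 2 * ((K.natAbs + 2 : ℕ) : ℝ) + K := by
    rw [Nat.cast_add, Nat.cast_natAbs, Int.cast_abs]
    push_cast
    linarith [neg_abs_le (K : ℝ), abs_nonneg (K : ℝ)]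
  have d1 : PolyDecay (K.natAbs + 2 : ℕ) fun x => (-(n + 1) : ℂ) * expPi 1 x :=
    (polyDecay_expPi one_pos _).const_mul _
  have d2 : PolyDecay (K.natAbs + 2 : ℕ) fun x => (-2 : ℂ) * (-(Real.pi * x) * expPi 1 x) :=
    ((((polyDecay_expPi one_pos (K.natAbs + 2 + 1)).zpow_mul 1
      (by push_cast; ring)).const_mul (-(Real.pi : ℂ))).congr
        fun x _ => by rw [zpow_one]; ring).const_mul _
  have e : latticeSum K (fun x => (1 - (((n : ℤ) + 2 : ℤ) : ℂ) + 2 * (Real.pi * x)) * expPi 1 x) z =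
      latticeSum K (fun x => (-(n + 1) : ℂ) * expPi 1 x + (-2 : ℂ) * (-(Real.pi * x) * expPi 1 x)) z :=
    latticeSum_congr (fun x _ => by push_cast; ring) hz
  rw [e, latticeSum_add d1 d2 hdec hz, latticeSum_const_mul, latticeSum_const_mul, ← hd]
  have hfin : (n : ℂ) * δ = 0 := by
    rw [hδ]
    split_ifs with h0
    · have : n = 0 := by omega
      simp [this]
    · simp
  change -(n + 1 : ℂ) * f 1 + -2 * d = δ
  linear_combination hu + hfin

/-- Here the radial functions agree only up to an exponential term, which `latticeSum_boundary`
sums. -/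
theorem xi_entirePart_of_two_le {k : ℤ} (hke : Even k) (hk : 2 ≤ k) (s : ℂ) (z : ℍ) :
    xi k (fun w => entirePart k s w) z =
      conj s * (conj s + k - 1) * entirePart (2 - k) (-conj s) z + if k = 2 then 1 / 2 else 0 := by
  have hbd := latticeSum_boundary hke hk (z := z) z.im_pos
  obtain ⟨n, rfl⟩ : ∃ n : ℕ, k = n + 2 := ⟨(k - 2).toNat, by omega⟩
  have h1 : ((n : ℤ) + 2).toNat = n + 2 := by omega
  have h2 : ((n : ℤ) + 2).natAbs = n + 2 := by omega
  have h3 : (2 - ((n : ℤ) + 2)).toNat = 0 := by omega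
  have h4 : (2 - ((n : ℤ) + 2)).natAbs = n := by omega
  have hpi : (Real.pi : ℂ) ≠ 0 := by exact_mod_cast Real.pi_ne_zero
  set K : ℤ := 2 - ((n : ℤ) + 2) with hK
  set σ := conj s with hσ
  have e : latticeSum K (fun x => -((x : ℂ) ^ K * conj (kernelDeriv ((n : ℤ) + 2) s x))) z =
      latticeSum K (fun x => (Real.pi : ℂ)⁻¹ * (σ * (σ + n + 1)) * kernel K (-σ) x +
        (Real.pi : ℂ)⁻¹ * ((1 - (((n : ℤ) + 2 : ℤ) : ℂ) + 2 * (Real.pi * x)) * expPi 1 x)) z := by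
    refine latticeSum_congr (fun x hx => ?_) z.im_pos
    have hx' : (x : ℂ) ≠ 0 := by exact_mod_cast hx.ne'
    -- `r1` and `r3` lower the parameter σ+n+3 to σ+n+1; `r2` and `r4` lower 2-σ to -σ. These
    -- endpoints are the parameters of `kernel K (-σ)`.
    have r1 := incGamma_recurrence (σ + n + 2) hx
    have r2 := incGamma_recurrence (1 - σ) hx
    have r3 := incGamma_recurrence (σ + n + 1) hx
    have r4 := incGamma_recurrence (-σ) hx
    have hE : (Real.exp (-(Real.pi * x)) : ℂ) = expPi 1 x := by rw [expPi, mul_one]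
    have z1 : (x : ℂ) ^ K * (x : ℂ) ^ (((n + 2 : ℕ) : ℤ) - 1) = x := by
      rw [← zpow_add₀ hx', show K + (((n + 2 : ℕ) : ℤ) - 1) = 1 by push_cast; omega, zpow_one]
    have z2 : (x : ℂ) ^ K * (x : ℂ) ^ ((n + 2 : ℕ) : ℤ) = x ^ 2 := by
      rw [← zpow_add₀ hx', show K + ((n + 2 : ℕ) : ℤ) = 2 by push_cast; omega]
      rfl
    rw [hE] at r1 r2 r3 r4
    rw [kernelDeriv, kernel, h1, h2, h3, h4]
    simp only [map_add, map_mul, incGamma_conj, map_neg, Complex.conj_ofReal, map_natCast,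
      map_zpow₀, map_sub, map_one, ← hσ, Nat.cast_zero, add_zero, pow_zero, one_mul]
    rw [mul_add, mul_left_comm ((x : ℂ) ^ K), ← mul_assoc ((x : ℂ) ^ K), z1,
      mul_left_comm ((x : ℂ) ^ K), ← mul_assoc ((x : ℂ) ^ K), z2]
    have a1 : σ + ((n + 2 : ℕ) : ℂ) = σ + n + 2 := by push_cast; ring
    have a2 : ((n + 2 : ℕ) : ℂ) + 1 - (σ + n + 2) = 1 - σ := by push_cast; ring
    have a3 : (n : ℂ) + 1 - -σ = σ + n + 1 := by ring
    have a4 : σ + n + 1 + 1 = σ + n + 2 := by ring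
    have a5 : -σ + 1 = 1 - σ := by ring
    rw [a4] at r3
    rw [a5] at r4
    rw [a1, a2, a3]
    push_cast
    field_simp
    linear_combination (-(Real.pi : ℂ) * x) * r1 - Real.pi * x * r2 - σ * r3 + (σ + n + 1) * r4
  -- A natural number, because `polyDecay_expPi` has natural exponents, and large enough for the
  -- kernel bound and for convergence.
  set N : ℕ := ⌈‖-σ‖⌉₊ + 2 * n + 2 with hN
  have hN' : (N : ℝ) = ⌈‖-σ‖⌉₊ + 2 * n + 2 := by rw [hN]; push_cast; ring
  have hceil := Nat.le_ceil ‖-σ‖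
  have hn0 : (0 : ℝ) ≤ n := by positivity
  have hc0 : (0 : ℝ) ≤ (⌈‖-σ‖⌉₊ : ℝ) := by positivity
  have d1 : PolyDecay N fun x => (Real.pi : ℂ)⁻¹ * (σ * (σ + n + 1)) * kernel K (-σ) x := by
    have := polyDecay_kernel K (s := -σ) (A := N) (by rw [h4, hN']; linarith)
    rw [h3, Nat.cast_zero, sub_zero] at this
    exact this.const_mul _
  have d2 : PolyDecay N fun x => (Real.pi : ℂ)⁻¹ *
      ((1 - (((n : ℤ) + 2 : ℤ) : ℂ) + 2 * (Real.pi * x)) * expPi 1 x) := by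
    have d3 := (polyDecay_expPi one_pos N).const_mul (1 - (((n : ℤ) + 2 : ℤ) : ℂ))
    have d4 := ((polyDecay_expPi one_pos (N + 1)).zpow_mul (B := N) 1
      (by push_cast; ring)).const_mul (2 * (Real.pi : ℂ))
    exact ((d3.add d4).congr fun x _ => by rw [zpow_one]; ring).const_mul _
  have hKr : (K : ℝ) = -n := by
    rw [hK]
    push_cast
    ring
  rw [xi_entirePart, ← hK, e, latticeSum_add d1 d2 (by rw [hKr, hN']; linarith) z.im_pos,
    latticeSum_const_mul, latticeSum_const_mul, hbd, entirePart, h2, h4]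
  have e2 : (Real.pi : ℂ) ^ (((n + 2 : ℕ) : ℂ) / 2) = (Real.pi : ℂ) ^ ((n : ℂ) / 2) * Real.pi := by
    rw [show ((n + 2 : ℕ) : ℂ) / 2 = (n : ℂ) / 2 + 1 by push_cast; ring, Complex.cpow_add _ _ hpi,
      Complex.cpow_one]
  have e3 : (Real.pi : ℂ) * (Real.pi : ℂ)⁻¹ = 1 := mul_inv_cancel₀ hpi
  rw [e2]
  by_cases h0 : (n : ℤ) + 2 = 2
  · have hn : n = 0 := by omega
    subst hn
    simp only [h0, if_true]
    push_cast
    rw [zero_div, Complex.cpow_zero]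
    linear_combination ((1 / 2 : ℂ) * (σ * (σ + 0 + 1)) * latticeSum K (kernel K (-σ)) z +
      1 / 2) * e3
  · simp only [h0, if_false]
    push_cast
    linear_combination ((1 / 2 : ℂ) * (Real.pi : ℂ) ^ ((n : ℂ) / 2) * (σ * (σ + n + 1)) *
      latticeSum K (kernel K (-σ)) z) * e3

end PolyharmonicMaass

/-! ### Meromorphic continuation in s -/

namespace PolyharmonicMaass

theorem toMeromorphicNFOn_eq_of_analyticAt {F : ℂ → ℂ} (hF : MeromorphicOn F Set.univ) {s : ℂ}
    (hs : AnalyticAt ℂ F s) : toMeromorphicNFOn F Set.univ s = F s := by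
  rw [toMeromorphicNFOn_eq_toMeromorphicNFAt hF (Set.mem_univ s),
    toMeromorphicNFAt_eq_self.2 hs.meromorphicNFAt]

/-- The difference has infinite order at σ+1, hence everywhere since the plane is connected. Normal
form upgrades equality on punctured neighbourhoods to equality at each point. -/
theorem IsMeromorphicContinuation.unique {F G f : ℂ → ℂ} {σ : ℝ}
    (hF : IsMeromorphicContinuation F f σ) (hG : IsMeromorphicContinuation G f σ) : F = G := by
  funext s
  have hm : MeromorphicOn (F - G) Set.univ := hF.1.meromorphicOn.sub hG.1.meromorphicOn
  have h0 : meromorphicOrderAt (F - G) ((σ + 1 : ℝ) : ℂ) = ⊤ := by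
    rw [meromorphicOrderAt_eq_top_iff]
    refine Filter.Eventually.filter_mono nhdsWithin_le_nhds ?_
    have : {w : ℂ | σ < w.re} ∈ 𝓝 ((σ + 1 : ℝ) : ℂ) :=
      (isOpen_lt continuous_const Complex.continuous_re).mem_nhds (by simp)
    filter_upwards [this] with w hw
    rw [Pi.sub_apply, hF.2 w hw, hG.2 w hw, sub_self]
  have h1 : meromorphicOrderAt (F - G) s = ⊤ := by
    by_contra h
    exact hm.meromorphicOrderAt_ne_top_of_isPreconnected isPreconnected_univ (Set.mem_univ s)
      (Set.mem_univ _) h h0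
  rw [meromorphicOrderAt_eq_top_iff] at h1
  have h2 : F =ᶠ[𝓝[≠] s] G := by
    filter_upwards [h1] with w hw
    exact sub_eq_zero.1 hw
  exact (((hF.1 (Set.mem_univ s)).eventuallyEq_nhdsNE_iff_eventuallyEq_nhds
    (hG.1 (Set.mem_univ s))).1 h2).eq_of_nhds

theorem analyticAt_entirePart_add_polarPart (k : ℤ) (z : ℍ) {s : ℂ}
    (hs : ¬ IsEisensteinPole k s) :
    AnalyticAt ℂ (fun s => entirePart k s z + polarPart k s) s := by
  refine ((differentiable_entirePart k z.im_pos).analyticAt s).add ?_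
  unfold polarPart
  split_ifs with h0
  · have h1 : s ≠ 0 := fun h => hs ⟨h0, Or.inl h⟩
    have h2 : s - 1 ≠ 0 := fun h => hs ⟨h0, Or.inr (sub_eq_zero.1 h)⟩
    fun_prop (disch := assumption)
  · exact analyticAt_const

theorem meromorphicOn_entirePart_add_polarPart (k : ℤ) (z : ℍ) :
    MeromorphicOn (fun s => entirePart k s z + polarPart k s) Set.univ := by
  intro s _
  refine ((differentiable_entirePart k z.im_pos).analyticAt s).meromorphicAt.add ?_
  unfold polarPart
  split_ifs with h0
  · fun_prop
  · exact MeromorphicAt.const _ _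

theorem isMeromorphicContinuation_entirePart_add_polarPart {k : ℤ} (hk : Even k) (z : ℍ) :
    IsMeromorphicContinuation
      (toMeromorphicNFOn (fun s => entirePart k s z + polarPart k s) Set.univ)
      (completedEisensteinSeries k z) (1 - (k : ℝ) / 2) := by
  refine ⟨meromorphicNFOn_toMeromorphicNFOn _ _, fun s hs => ?_⟩
  rw [completedEisensteinSeries_eq hk z hs]
  refine toMeromorphicNFOn_eq_of_analyticAt (meromorphicOn_entirePart_add_polarPart k z)
    (analyticAt_entirePart_add_polarPart k z ?_)
  rintro ⟨rfl, rfl | rfl⟩ <;> norm_num at hs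

theorem isMeromorphicContinuation_completedEisenstein {k : ℤ} (hk : Even k) (z : ℍ) :
    IsMeromorphicContinuation (completedEisenstein k z)
      (completedEisensteinSeries k z) (1 - (k : ℝ) / 2) :=
  Classical.epsilon_spec (p := fun F => IsMeromorphicContinuation F
    (completedEisensteinSeries k z) (1 - (k : ℝ) / 2))
    ⟨_, isMeromorphicContinuation_entirePart_add_polarPart hk z⟩

/-- Uniqueness identifies the continuation picked by `Classical.epsilon`. -/
theorem completedEisenstein_eq_toMeromorphicNFOn {k : ℤ} (hk : Even k) (z : ℍ) :
    completedEisenstein k z =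
      toMeromorphicNFOn (fun s => entirePart k s z + polarPart k s) Set.univ :=
  (isMeromorphicContinuation_completedEisenstein hk z).unique
    (isMeromorphicContinuation_entirePart_add_polarPart hk z)

theorem completedEisenstein_eq {k : ℤ} (hk : Even k) (z : ℍ) {s : ℂ}
    (hs : ¬ IsEisensteinPole k s) :
    completedEisenstein k z s = entirePart k s z + polarPart k s := by
  rw [completedEisenstein_eq_toMeromorphicNFOn hk]
  exact toMeromorphicNFOn_eq_of_analyticAt (meromorphicOn_entirePart_add_polarPart k z)
    (analyticAt_entirePart_add_polarPart k z hs)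

theorem eventually_not_isEisensteinPole (k : ℤ) (s : ℂ) :
    ∀ᶠ t in 𝓝[≠] s, ¬ IsEisensteinPole k t := by
  have h : ({0, 1} : Set ℂ)ᶜ ∈ 𝓝[≠] s := by
    have := (Set.toFinite ({0, 1} : Set ℂ)).isClosed.isOpen_compl
    by_cases hs : s ∈ ({0, 1} : Set ℂ)
    · have h1 := ((Set.toFinite (({0, 1} : Set ℂ) \ {s})).isClosed.isOpen_compl).mem_nhds
        (show s ∈ (({0, 1} : Set ℂ) \ {s})ᶜ by simp)
      filter_upwards [mem_nhdsWithin_of_mem_nhds h1, self_mem_nhdsWithin] with t h2 h3 h4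
      exact h2 ⟨h4, h3⟩
    · exact mem_nhdsWithin_of_mem_nhds (this.mem_nhds hs)
  filter_upwards [h] with t ht hp
  exact ht hp.2

theorem analyticAt_completedEisenstein {k : ℤ} (hk : Even k) (z : ℍ) {s : ℂ}
    (hs : ¬ IsEisensteinPole k s) : AnalyticAt ℂ (completedEisenstein k z) s := by
  refine (analyticAt_entirePart_add_polarPart k z hs).congr ?_
  refine eventuallyEq_nhds_of_eventuallyEq_nhdsNE ?_ (completedEisenstein_eq hk z hs).symm
  filter_upwards [eventually_not_isEisensteinPole k s] with t ht
  exact (completedEisenstein_eq hk z ht).symm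

/-- In weight 0, s(s-1) times the polar part is the constant 1/2. -/
theorem doublyCompletedEisenstein_eq {k : ℤ} (hk : Even k) (z : ℍ) :
    doublyCompletedEisenstein k z = fun s =>
      (s + (k : ℂ) / 2) * (s + (k : ℂ) / 2 - 1) * entirePart k s z +
        if k = 0 then 1 / 2 else 0 := by
  set D : ℂ → ℂ := fun s => (s + (k : ℂ) / 2) * (s + (k : ℂ) / 2 - 1) * entirePart k s z +
        if k = 0 then 1 / 2 else 0 with hD
  have hDa : Differentiable ℂ D :=
    (((differentiable_id.add_const _).mul ((differentiable_id.add_const _).sub_const _)).mul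
      (differentiable_entirePart k z.im_pos)).add_const _
  have hm : MeromorphicOn (fun s : ℂ => (s + (k : ℂ) / 2) * (s + (k : ℂ) / 2 - 1) *
      completedEisenstein k z s) Set.univ := by
    intro s hs
    have h1 := (isMeromorphicContinuation_completedEisenstein hk z).1.meromorphicOn s hs
    exact (show MeromorphicAt (fun s : ℂ => (s + (k : ℂ) / 2) * (s + (k : ℂ) / 2 - 1)) s by
      fun_prop).mul h1
  funext s
  have he : (fun s : ℂ => (s + (k : ℂ) / 2) * (s + (k : ℂ) / 2 - 1) *
      completedEisenstein k z s) =ᶠ[𝓝[≠] s] D := by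
    filter_upwards [eventually_not_isEisensteinPole k s] with t ht
    rw [completedEisenstein_eq hk z ht, hD, polarPart]
    dsimp only
    split_ifs with h0
    · have h1 : t ≠ 0 := fun h => ht ⟨h0, Or.inl h⟩
      have h2 : t - 1 ≠ 0 := fun h => ht ⟨h0, Or.inr (sub_eq_zero.1 h)⟩
      subst h0
      simp only [Int.cast_zero, zero_div, add_zero]
      field_simp
      ring
    · ring
  rw [doublyCompletedEisenstein, toMeromorphicNFOn_eq_toMeromorphicNFAt hm (Set.mem_univ s),
    (toMeromorphicNFAt_eventuallyEq_nhds_congr he).eq_of_nhds,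
    toMeromorphicNFAt_eq_self.2 (hDa.analyticAt s).meromorphicNFAt]

/-- Terms independent of z, such as the polar part, are annihilated by ∂/∂z̄; scalars come out
conjugated. -/
theorem xi_const_mul_entirePart_add (k : ℤ) (s A B : ℂ) {f : ℍ → ℂ} (z : ℍ)
    (hf : ∀ w : ℍ, f w = A * entirePart k s w + B) :
    RealDifferentiableAt f z ∧ xi k f z = conj A * xi k (fun w => entirePart k s w) z := by
  have hd := differentiableAt_entirePart k s (z := z) z.im_pos
  refine ⟨realDifferentiableAt_of_eq (F := fun w => A * entirePart k s w + B) hf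
    ((hd.const_mul A).add_const B), ?_⟩
  have hy : ((z.im : ℝ) : ℂ) ≠ 0 := by exact_mod_cast z.im_pos.ne'
  set W := -((z.im : ℝ) : ℂ) ^ 2 / Complex.I * (fderiv ℝ (entirePart k s) z 1 +
    Complex.I * fderiv ℝ (entirePart k s) z Complex.I) with hW
  have h1 : fderiv ℝ (entirePart k s) z 1 + Complex.I * fderiv ℝ (entirePart k s) z Complex.I =
      -Complex.I / ((z.im : ℝ) : ℂ) ^ 2 * W := by
    rw [hW]
    have := Complex.I_ne_zero
    field_simp
  rw [xi_of_eq (F := fun w => A * entirePart k s w + B) hf k (W := A * W),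
    xi_of_eq (f := fun w => entirePart k s w) (fun _ => rfl) k h1, map_mul]
  · ring
  · rw [fderiv_add_const, fderiv_const_mul hd]
    simp only [smul_apply, smul_eq_mul]
    rw [mul_left_comm Complex.I, ← mul_add, h1]
    ring

end PolyharmonicMaass

/-! ### The proposition -/

theorem mainTheorem10 (k : ℤ) (hk : Even k) :
    -- the series have continuations, and `ξ_k` is applied to differentiable functions
    (∀ z : ℍ,
      PolyharmonicMaass.IsMeromorphicContinuation
        (PolyharmonicMaass.completedEisenstein k z)
        (PolyharmonicMaass.completedEisensteinSeries k z) (1 - (k : ℝ) / 2) ∧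
      (∀ s : ℂ, ¬ PolyharmonicMaass.IsEisensteinPole k s →
        AnalyticAt ℂ (PolyharmonicMaass.completedEisenstein k z) s ∧
        PolyharmonicMaass.RealDifferentiableAt
          (fun w => PolyharmonicMaass.completedEisenstein k w s) z) ∧
      Differentiable ℂ (PolyharmonicMaass.doublyCompletedEisenstein k z) ∧
      (∀ s : ℂ, PolyharmonicMaass.RealDifferentiableAt
        (fun w => PolyharmonicMaass.doublyCompletedEisenstein k w s) z)) ∧
    -- the completed series, `k ≤ 0`
    (k ≤ 0 → ∀ (z : ℍ) (s : ℂ), ¬ PolyharmonicMaass.IsEisensteinPole k s →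
      PolyharmonicMaass.xi k (fun w => PolyharmonicMaass.completedEisenstein k w s) z =
        PolyharmonicMaass.completedEisenstein (2 - k) z (-conj s)) ∧
    -- the completed series, `k ≥ 2`
    (2 ≤ k → ∀ (z : ℍ) (s : ℂ), ¬ PolyharmonicMaass.IsEisensteinPole (2 - k) (-conj s) →
      PolyharmonicMaass.xi k (fun w => PolyharmonicMaass.completedEisenstein k w s) z =
        conj s * (conj s + (k : ℂ) - 1) *
          PolyharmonicMaass.completedEisenstein (2 - k) z (-conj s)) ∧
    -- at the removable singularities of the right-hand side, it is read as its limit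
    (2 ≤ k → ∀ (z : ℍ) (s : ℂ), PolyharmonicMaass.IsEisensteinPole (2 - k) (-conj s) →
      Tendsto (fun t : ℂ => conj t * (conj t + (k : ℂ) - 1) *
          PolyharmonicMaass.completedEisenstein (2 - k) z (-conj t)) (𝓝[≠] s)
        (𝓝 (PolyharmonicMaass.xi k
          (fun w => PolyharmonicMaass.completedEisenstein k w s) z))) ∧
    -- the doubly-completed series
    (k ≤ 0 → ∀ (z : ℍ) (s : ℂ),
      PolyharmonicMaass.xi k (fun w => PolyharmonicMaass.doublyCompletedEisenstein k w s) z =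
        PolyharmonicMaass.doublyCompletedEisenstein (2 - k) z (-conj s)) ∧
    (2 ≤ k → ∀ (z : ℍ) (s : ℂ),
      PolyharmonicMaass.xi k (fun w => PolyharmonicMaass.doublyCompletedEisenstein k w s) z =
        conj s * (conj s + (k : ℂ) - 1) *
          PolyharmonicMaass.doublyCompletedEisenstein (2 - k) z (-conj s)) := by
  have hk' : Even (2 - k) := even_two.sub hk
  have hc : ∀ (s : ℂ), ¬ PolyharmonicMaass.IsEisensteinPole k s → ∀ z : ℍ,
      PolyharmonicMaass.RealDifferentiableAt
        (fun w => PolyharmonicMaass.completedEisenstein k w s) z ∧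
      PolyharmonicMaass.xi k (fun w => PolyharmonicMaass.completedEisenstein k w s) z =
        PolyharmonicMaass.xi k (fun w => PolyharmonicMaass.entirePart k s w) z := by
    intro s hs z
    have h := PolyharmonicMaass.xi_const_mul_entirePart_add k s 1 (PolyharmonicMaass.polarPart k s)
      (f := fun w => PolyharmonicMaass.completedEisenstein k w s) z fun w => by
        rw [PolyharmonicMaass.completedEisenstein_eq hk w hs, one_mul]
    rwa [map_one, one_mul] at h
  have hdc : ∀ (s : ℂ) (z : ℍ),
      PolyharmonicMaass.RealDifferentiableAt
        (fun w => PolyharmonicMaass.doublyCompletedEisenstein k w s) z ∧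
      PolyharmonicMaass.xi k (fun w => PolyharmonicMaass.doublyCompletedEisenstein k w s) z =
        conj ((s + (k : ℂ) / 2) * (s + (k : ℂ) / 2 - 1)) *
          PolyharmonicMaass.xi k (fun w => PolyharmonicMaass.entirePart k s w) z := fun s z =>
    PolyharmonicMaass.xi_const_mul_entirePart_add k s _ _
      (f := fun w => PolyharmonicMaass.doublyCompletedEisenstein k w s) z fun w => by
        rw [PolyharmonicMaass.doublyCompletedEisenstein_eq hk w]
  -- The completing quadratic factor is, up to conjugation, invariant under (k, s) ↦ (2-k, -s̄).
  have hP : ∀ s : ℂ, conj ((s + (k : ℂ) / 2) * (s + (k : ℂ) / 2 - 1)) =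
      (-conj s + ((2 - k : ℤ) : ℂ) / 2) * (-conj s + ((2 - k : ℤ) : ℂ) / 2 - 1) := by
    intro s
    simp only [map_mul, map_sub, map_add, map_div₀, map_intCast, map_one, map_ofNat]
    push_cast
    ring
  -- The polar part of the right-hand side equals the constant left by the boundary term.
  have hpol : ∀ s : ℂ, 2 ≤ k → ¬ PolyharmonicMaass.IsEisensteinPole (2 - k) (-conj s) →
      conj s * (conj s + k - 1) * PolyharmonicMaass.polarPart (2 - k) (-conj s) =
        if k = 2 then 1 / 2 else 0 := by
    intro s hk2 hs
    unfold PolyharmonicMaass.polarPart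
    by_cases h0 : k = 2
    · subst h0
      have h1 : -conj s ≠ 0 := fun h => hs ⟨by norm_num, Or.inl h⟩
      have h2 : -conj s - 1 ≠ 0 := fun h => hs ⟨by norm_num, Or.inr (sub_eq_zero.1 h)⟩
      have h3 : conj s ≠ 0 := fun h => h1 (by rw [h, neg_zero])
      simp only [sub_self, if_true]
      push_cast
      field_simp
      ring
    · rw [if_neg (by omega), if_neg h0, mul_zero]
  refine ⟨fun z => ⟨PolyharmonicMaass.isMeromorphicContinuation_completedEisenstein hk z,
    fun s hs => ⟨PolyharmonicMaass.analyticAt_completedEisenstein hk z hs, (hc s hs z).1⟩, ?_,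
    fun s => (hdc s z).1⟩, ?_, ?_, ?_, ?_, ?_⟩
  · rw [PolyharmonicMaass.doublyCompletedEisenstein_eq hk z]
    exact (((differentiable_id.add_const _).mul ((differentiable_id.add_const _).sub_const _)).mul
      (PolyharmonicMaass.differentiable_entirePart k z.im_pos)).add_const _
  · intro hk0 z s hs
    have h2 : 2 - k ≠ 0 := by omega
    rw [(hc s hs z).2, PolyharmonicMaass.xi_entirePart_of_nonpos hk0,
      PolyharmonicMaass.completedEisenstein_eq hk' z (fun h => h2 h.1),
      PolyharmonicMaass.polarPart, if_neg h2, add_zero]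
  · intro hk2 z s hs
    rw [(hc s (fun h => by have := h.1; omega) z).2,
      PolyharmonicMaass.xi_entirePart_of_two_le hk hk2,
      PolyharmonicMaass.completedEisenstein_eq hk' z hs, mul_add, hpol s hk2 hs]
  · intro hk2 z s hs
    rw [(hc s (fun h => by have := h.1; omega) z).2,
      PolyharmonicMaass.xi_entirePart_of_two_le hk hk2]
    -- This continuous function agrees with the right-hand side away from its removable
    -- singularities, so its value at `s` is the limit.
    have hcont : Continuous fun t : ℂ => conj t * (conj t + k - 1) *
        PolyharmonicMaass.entirePart (2 - k) (-conj t) z + if k = 2 then 1 / 2 else 0 := by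
      have h1 := (PolyharmonicMaass.differentiable_entirePart (2 - k) z.im_pos).continuous.comp
        (Complex.continuous_conj.neg)
      exact ((Complex.continuous_conj.mul ((Complex.continuous_conj.add continuous_const).sub
        continuous_const)).mul h1).add continuous_const
    refine (hcont.continuousAt.tendsto.mono_left nhdsWithin_le_nhds).congr' ?_
    have hev : ∀ᶠ t in 𝓝[≠] s, ¬ PolyharmonicMaass.IsEisensteinPole (2 - k) (-conj t) := by
      have h1 : Tendsto (fun t : ℂ => -conj t) (𝓝[≠] s) (𝓝[≠] (-conj s)) := by
        refine tendsto_nhdsWithin_of_tendsto_nhds_of_eventually_within _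
          ((Complex.continuous_conj.neg).continuousAt.tendsto.mono_left nhdsWithin_le_nhds) ?_
        filter_upwards [self_mem_nhdsWithin] with t ht h
        exact ht ((starRingEnd ℂ).injective (neg_injective h))
      exact h1.eventually (PolyharmonicMaass.eventually_not_isEisensteinPole (2 - k) (-conj s))
    filter_upwards [hev] with t ht
    rw [PolyharmonicMaass.completedEisenstein_eq hk' z ht, mul_add, hpol t hk2 ht]
  · intro hk0 z s
    have h2 : 2 - k ≠ 0 := by omega
    rw [(hdc s z).2, PolyharmonicMaass.xi_entirePart_of_nonpos hk0, hP,
      PolyharmonicMaass.doublyCompletedEisenstein_eq hk' z]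
    simp only [if_neg h2, add_zero]
  · intro hk2 z s
    rw [(hdc s z).2, PolyharmonicMaass.xi_entirePart_of_two_le hk hk2, hP,
      PolyharmonicMaass.doublyCompletedEisenstein_eq hk' z]
    -- For k = 2 the quadratic factor equals s̄(s̄+1), so the two constants 1/2 are multiplied by
    -- the same factor.
    by_cases h0 : k = 2
    · subst h0
      simp only [sub_self, if_true]
      push_cast
      ring
    · have h2 : 2 - k ≠ 0 := by omega
      simp only [if_neg h0, if_neg h2, add_zero]
      ring
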